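/- **Theorem (Simulation).** *Setting.* A finite abelian hypergroup $\mathcal T$ is a finite set with structure constants $n_{ab}^c\ge 0$ giving a commutative, associative, unital hyperoperation $ab=\sum_c n_{ab}^c\,c$, with an involution $a\mapsto\overline a$ satisfying $n_{\overline a\,\overline b}^{\overline c}=n_{ab}^c$, $n_{ab}^{1}\neq0\iff b=\overline a$, $\sum_c n_{ab}^c=1$ and reversibility $n_{ab}^c/w_c=n_{\overline a c}^b/w_b=n_{c\overline b}^a/w_a$, where $w_a=1/n_{a\overline a}^1$ is the weight of $a$ and $\varpi_{\mathcal T}=\sum_a w_a$. Characters are the non-zero $\mathcal X:\mathcal T\to\mathbb C$ with $\mathcal X(a)\mathcal X(b)=\sum_c n_{ab}^c\mathcal X(c)$ and $\mathcal X(\overline a)=\overline{\mathcal X(a)}$. All hypergroups are strong: the set of characters $\mathcal T^*$ with the pointwise product and complex conjugation has non-negative structure constants, so it is a hypergroup. $\mathcal T^{**}$ is identified with $\mathcal T$, an element $a$ being the character $\mathcal X\mapsto\overline{\mathcal X(a)}$ of $\mathcal T^*$. *Circuits.* A circuit starts in a basis state $|x\rangle$ with $x\in\mathcal T(0)\in\{\mathcal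 T,\mathcal T^*\}$. At each time the standard basis is labelled by the current hypergroup $\mathcal T(t)\in\{\mathcal T,\mathcal T^*\}$, and the allowed gates are: Pauli gates $|b\rangle\mapsto|ab\rangle$ for invertible $a\in\mathcal T(t)$ and $|b\rangle\mapsto\mathcal X(b)|b\rangle$ for invertible $\mathcal X\in\mathcal T(t)^*$; automorphism gates $|b\rangle\mapsto|\alpha(b)\rangle$ for automorphisms $\alpha$ of $\mathcal T(t)$; and the global QFT $|b\rangle\mapsto\sum_{\mathcal X\in\mathcal T(t)^*}\sqrt{w_{\mathcal X}w_b/\varpi_{\mathcal T(t)^*}}\;\mathcal X(b)\,|\mathcal X\rangle$, after which $\mathcal T(t+1)=\mathcal T(t)^*$. There are no quadratic phase gates and no partial QFTs. At the end the state is measured in the standard basis labelled by the final hypergroup. (If $\mathcal T_1\times\dots\times\mathcal T_m$ is a product and some registers start in element states and others in character states, then $\mathcal T$ denotes the product of the hypergroups that label the initial registers.) *Computability assumptions.* Consider a family of hypergroups $\mathcal T$, each given by a name of $\mathrm{polylog}|\mathcal T|$ bits; "efficiently" means by a classical program, uniform in the family, in time polynomial in $\log|\mathcal T|$ and in the length of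 any further input. Automorphisms of $\mathcal T$ and of $\mathcal T^*$ are described by bit strings in some fixed description scheme. $\mathcal T$ is *efficiently computable* if its elements are uniquely represented by $\mathrm{polylog}|\mathcal T|$ bits and one can efficiently perform the hypergroup multiplication: compute each constant $n_{ab}^c$ within error $2^{-k}$ in time $\mathrm{poly}(\log|\mathcal T|,k)$, and compute the element $ab$ for invertible $a$ and any $b$, and the inverse of an invertible $a$. The family is *doubly efficiently computable* with sampling accuracy $\varepsilon:\mathbb N\to[0,\infty)$ if $\mathcal T$ and $\mathcal T^*$ are efficiently computable and 1. each character value $\mathcal X_\mu(a)$ can be computed within error $2^{-k}$ (in each of its real and imaginary parts) in time $\mathrm{poly}(\log|\mathcal T|,k)$; 2. for fixed $\mathcal X_\mu\in\mathcal T^*$ the distribution $p_a=\frac{w_aw_{\mathcal X_\mu}}{\varpi_{\mathcal T}}|\mathcal X_\mu(a)|^2$ on $\mathcal T$, and for fixed $a\in\mathcal T$ the distribution $q_\mu=\frac{w_aw_{\mathcal X_\mu}}{\varpi_{\mathcal T}}|\mathcal X_\mu(a)|^2$ on $\mathcal T^*$, can be sampled by a coin-flipping program within total variation distance $\varepsilon(k)$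 in time $\mathrm{poly}(\log|\mathcal T|,k)$; 3. from the description of an automorphism $\alpha$ of $\mathcal T$ or of $\mathcal T^*$ one can efficiently evaluate $\alpha$ and find descriptions of the inverse $\alpha^{-1}$ and of the dual automorphism $\alpha^*:\mathcal X\mapsto\mathcal X\circ\alpha$. *Claim.* For every $\varepsilon$ and every family of finite abelian hypergroups that is doubly efficiently computable with sampling accuracy $\varepsilon$ there is a single classical probabilistic program which, given the name of $\mathcal T$, a classical description of a circuit $\mathcal C$ as above (the list of its gates, Pauli gates being described by the representation of their element or character and automorphism gates by a description of the automorphism), the initial basis state $x$ and $k$ in unary, samples from the distribution of the measurement outcome of $\mathcal C|x\rangle$ within total variation distance $\varepsilon(k)$, in time polynomial in $\log|\mathcal T|$, the length of the description of $\mathcal C$, and $k$. -/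

import Mathlib

open scoped NNReal ComplexConjugate

noncomputable section

namespace HypergroupSim

/-! ## Finite abelian hypergroups, their characters and the dual hypergroup -/

open Classical in
/-- A finite abelian hypergroup structure on the finite set `T`: the real number `n a b c` is the
structure constant `n_{ab}^c` of the hyperoperation `a b = ∑ c, n_{ab}^c c`. -/
structure Hypergroup (T : Type) [Fintype T] where
  one : T
  bar : T → T
  n : T → T → T → ℝ
  nonneg : ∀ a b c, 0 ≤ n a b c
  comm : ∀ a b c, n a b c = n b a c
  assoc : ∀ a b c d, ∑ e, n a b e * n e c d = ∑ e, n b c e * n a e d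
  one_mul : ∀ a b, n one a b = if b = a then 1 else 0
  bar_bar : ∀ a, bar (bar a) = a
  n_bar : ∀ a b c, n (bar a) (bar b) (bar c) = n a b c
  anti : ∀ a b, n a b one ≠ 0 ↔ b = bar a
  sum_one : ∀ a b, ∑ c, n a b c = 1
  /-- Reversibility `n_{xy}^z / w_z = n_{x̄z}^y / w_y` where `w_x = 1 / n_{x x̄}^1`. -/
  rev_left : ∀ x y z, n x y z * n z (bar z) one = n (bar x) z y * n y (bar y) one
  /-- Reversibility `n_{xy}^z / w_z = n_{zȳ}^x / w_x`. -/
  rev_right : ∀ x y z, n x y z * n z (bar z) one = n z (bar y) x * n x (bar x) one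

namespace Hypergroup

variable {T : Type} [Fintype T] (H : Hypergroup T)

/-- The weight `w_a = 1 / n_{a ā}^1` of an element. -/
def weight (a : T) : ℝ := 1 / H.n a (H.bar a) H.one

/-- The total weight `ϖ_T`. -/
def totalWeight : ℝ := ∑ a, H.weight a

/-- `a` is invertible: `a b = 1` for some element `b`. -/
def IsInvertible (a : T) : Prop := ∃ b, H.n a b H.one = 1

/-- Characters of a hypergroup. -/
structure IsCharacter (χ : T → ℂ) : Prop where
  ne_zero : χ ≠ 0
  mul : ∀ a b, χ a * χ b = ∑ c, (H.n a b c : ℂ) * χ c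
  bar : ∀ a, χ (H.bar a) = conj (χ a)

/-- The set of characters. -/
abbrev Character : Type := {χ : T → ℂ // H.IsCharacter χ}

/-- Hypergroup automorphisms. -/
structure Aut where
  toEquiv : T ≃ T
  map_n : ∀ a b c, H.n (toEquiv a) (toEquiv b) (toEquiv c) = H.n a b c
  map_bar : ∀ a, toEquiv (H.bar a) = H.bar (toEquiv a)

/-! ### Facts needed to turn the set of characters into a hypergroup -/

theorem norm_const_pos (a : T) : 0 < H.n a (H.bar a) H.one :=
  lt_of_le_of_ne (H.nonneg _ _ _) (Ne.symm ((H.anti _ _).2 rfl))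

theorem weight_pos (a : T) : 0 < H.weight a := one_div_pos.2 (H.norm_const_pos a)

theorem totalWeight_pos : 0 < H.totalWeight :=
  Finset.sum_pos (fun a _ => H.weight_pos a) ⟨H.one, Finset.mem_univ _⟩

theorem weight_rev (b a c : T) :
    H.weight a * H.n b a c = H.weight c * H.n (H.bar b) c a := by
  have h := H.rev_left b a c
  have h1 := (H.norm_const_pos a).ne'
  have h2 := (H.norm_const_pos c).ne'
  unfold weight
  field_simp
  linarith

variable {H} in
theorem IsCharacter.map_one {χ : T → ℂ} (h : H.IsCharacter χ) : χ H.one = 1 := by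
  obtain ⟨a, ha⟩ := Function.ne_iff.1 h.ne_zero
  have := h.mul H.one a
  rw [Finset.sum_eq_single a (fun c _ hc => by rw [H.one_mul, if_neg hc]; simp)
    (fun h => absurd (Finset.mem_univ _) h), H.one_mul, if_pos rfl, Complex.ofReal_one] at this
  exact mul_right_cancel₀ (b := χ a) ha this

/-- The (unnormalized) weighted inner product on functions. -/
def ip (f g : T → ℂ) : ℂ := ∑ a, (H.weight a : ℂ) * (conj (f a) * g a)

theorem ip_self_pos (χ : H.Character) : 0 < ∑ a, H.weight a * ‖χ.1 a‖ ^ 2 := by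
  refine Finset.sum_pos' (fun a _ => mul_nonneg (H.weight_pos a).le (sq_nonneg _))
    ⟨H.one, Finset.mem_univ _, ?_⟩
  rw [χ.2.map_one]
  simpa using H.weight_pos _

theorem ip_self (f : T → ℂ) : H.ip f f = ((∑ a, H.weight a * ‖f a‖ ^ 2 : ℝ) : ℂ) := by
  unfold ip
  push_cast
  refine Finset.sum_congr rfl fun a _ => ?_
  rw [Complex.conj_mul']

theorem ip_self_ne (χ : H.Character) : H.ip χ.1 χ.1 ≠ 0 := by
  rw [ip_self]
  exact_mod_cast (H.ip_self_pos χ).ne'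

theorem ip_ne {χ ψ : H.Character} (hne : χ ≠ ψ) : H.ip χ.1 ψ.1 = 0 := by
  have key : ∀ b, ψ.1 b * H.ip χ.1 ψ.1 = χ.1 b * H.ip χ.1 ψ.1 := by
    intro b
    have h1 : ψ.1 b * H.ip χ.1 ψ.1
        = ∑ a, ∑ c, (H.weight a : ℂ) * (H.n b a c : ℂ) * (conj (χ.1 a) * ψ.1 c) := by
      unfold ip
      rw [Finset.mul_sum]
      refine Finset.sum_congr rfl fun a _ => ?_
      have := ψ.2.mul b a
      calc ψ.1 b * ((H.weight a : ℂ) * (conj (χ.1 a) * ψ.1 a))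
          = (H.weight a : ℂ) * conj (χ.1 a) * (ψ.1 b * ψ.1 a) := by ring
        _ = _ := by
          rw [this, Finset.mul_sum]
          exact Finset.sum_congr rfl fun c _ => by ring
    have h2 : χ.1 b * H.ip χ.1 ψ.1
        = ∑ c, ∑ a, (H.weight c : ℂ) * (H.n (H.bar b) c a : ℂ) * (conj (χ.1 a) * ψ.1 c) := by
      unfold ip
      rw [Finset.mul_sum]
      refine Finset.sum_congr rfl fun c _ => ?_
      have h := congrArg conj (χ.2.mul (H.bar b) c)
      rw [map_mul, χ.2.bar, Complex.conj_conj, map_sum] at h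
      calc χ.1 b * ((H.weight c : ℂ) * (conj (χ.1 c) * ψ.1 c))
          = (H.weight c : ℂ) * ψ.1 c * (χ.1 b * conj (χ.1 c)) := by ring
        _ = _ := by
          rw [h, Finset.mul_sum]
          refine Finset.sum_congr rfl fun a _ => ?_
          rw [map_mul, Complex.conj_ofReal]
          ring
    rw [h1, h2, Finset.sum_comm]
    refine Finset.sum_congr rfl fun c _ => Finset.sum_congr rfl fun a _ => ?_
    have := H.weight_rev b a c
    rw [← Complex.ofReal_mul, ← Complex.ofReal_mul, this]
  by_contra h
  exact hne (Subtype.ext (funext fun b => (mul_right_cancel₀ h (key b)).symm))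

theorem ip_sum {ι : Type*} (s : Finset ι) (f : T → ℂ) (m : ι → ℂ) (g : ι → T → ℂ) :
    H.ip f (fun a => ∑ i ∈ s, m i * g i a) = ∑ i ∈ s, m i * H.ip f (g i) := by
  unfold ip
  simp only [Finset.mul_sum]
  rw [Finset.sum_comm]
  refine Finset.sum_congr rfl fun i _ => Finset.sum_congr rfl fun a _ => by ring

theorem linearIndependent_characters :
    LinearIndependent ℂ (fun χ : H.Character => χ.1) := by
  rw [linearIndependent_iff']
  intro s m hm i hi
  have h0 : (fun a => ∑ j ∈ s, m j * j.1 a) = (0 : T → ℂ) := by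
    rw [← hm]
    funext a
    simp
  have h1 := H.ip_sum s i.1 m (fun j => j.1)
  rw [h0, Finset.sum_eq_single i (fun j _ hj => by rw [H.ip_ne (Ne.symm hj), mul_zero])
    (fun h => absurd hi h)] at h1
  have h2 : H.ip i.1 (0 : T → ℂ) = 0 := by simp [ip]
  rw [h2] at h1
  exact (mul_eq_zero.1 h1.symm).resolve_right (H.ip_self_ne i)

instance : Finite H.Character := H.linearIndependent_characters.finite

instance : Fintype H.Character := Fintype.ofFinite _

/-- A hypergroup is strong when products of characters expand in characters with nonnegative
coefficients `m_{μν}^γ` (which are unique). -/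
def Strong : Prop :=
  ∀ μ ν : H.Character, ∃ m : H.Character → ℝ, (∀ γ, 0 ≤ m γ) ∧
    ∀ a, μ.1 a * ν.1 a = ∑ γ : H.Character, (m γ : ℂ) * γ.1 a

variable {H}

theorem ip_expand (m : H.Character → ℝ) (f : T → ℂ)
    (h : ∀ a, f a = ∑ γ : H.Character, (m γ : ℂ) * γ.1 a) (γ : H.Character) :
    H.ip γ.1 f = (m γ : ℂ) * H.ip γ.1 γ.1 := by
  have hf : f = fun a => ∑ γ : H.Character, (m γ : ℂ) * γ.1 a := funext h
  rw [hf, H.ip_sum Finset.univ γ.1 (fun γ => (m γ : ℂ)) (fun γ => γ.1),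
    Finset.sum_eq_single γ (fun j _ hj => by rw [H.ip_ne (Ne.symm hj), mul_zero])
      (fun h => absurd (Finset.mem_univ _) h)]

theorem coef_ext (m m' : H.Character → ℝ)
    (h : ∀ a, ∑ γ : H.Character, (m γ : ℂ) * γ.1 a = ∑ γ : H.Character, (m' γ : ℂ) * γ.1 a)
    (γ : H.Character) : m γ = m' γ := by
  have h1 := ip_expand m _ (fun a => rfl) γ
  have h2 := ip_expand m' _ h γ
  have := h1.symm.trans h2
  exact_mod_cast mul_right_cancel₀ (H.ip_self_ne γ) this

variable (H)

/-- The trivial character. -/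
def trivialChar : H.Character :=
  ⟨fun _ => 1, by
    refine ⟨fun h => one_ne_zero (congrFun h H.one), fun a b => ?_, fun a => by simp⟩
    have := H.sum_one a b
    simp only [mul_one]
    exact_mod_cast this.symm⟩

variable {H}

/-- The complex conjugate of a character. -/
def conjChar (χ : H.Character) : H.Character :=
  ⟨fun a => conj (χ.1 a), by
    refine ⟨fun h => χ.2.ne_zero (funext fun a => ?_), fun a b => ?_, fun a => ?_⟩
    · have := congrFun h a
      simpa using this
    · rw [← map_mul, χ.2.mul, map_sum]
      exact Finset.sum_congr rfl fun c _ => by rw [map_mul, Complex.conj_ofReal]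
    · rw [χ.2.bar]⟩

theorem conjChar_conjChar (χ : H.Character) : conjChar (conjChar χ) = χ :=
  Subtype.ext (funext fun _ => Complex.conj_conj _)

/-- The structure constants `m_{μν}^γ` of the set of characters. -/
def Strong.m (hs : H.Strong) (μ ν γ : H.Character) : ℝ := (hs μ ν).choose γ

theorem Strong.m_nonneg (hs : H.Strong) (μ ν γ : H.Character) : 0 ≤ hs.m μ ν γ :=
  (hs μ ν).choose_spec.1 γ

theorem Strong.mul_eq (hs : H.Strong) (μ ν : H.Character) (a : T) :
    μ.1 a * ν.1 a = ∑ γ : H.Character, (hs.m μ ν γ : ℂ) * γ.1 a :=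
  (hs μ ν).choose_spec.2 a

theorem Strong.m_eq (hs : H.Strong) (μ ν : H.Character) (m' : H.Character → ℝ)
    (h : ∀ a, μ.1 a * ν.1 a = ∑ γ : H.Character, (m' γ : ℂ) * γ.1 a) (γ : H.Character) :
    hs.m μ ν γ = m' γ :=
  coef_ext _ _ (fun a => (hs.mul_eq μ ν a).symm.trans (h a)) γ

theorem Strong.m_ip (hs : H.Strong) (μ ν γ : H.Character) :
    H.ip γ.1 (fun a => μ.1 a * ν.1 a) = (hs.m μ ν γ : ℂ) * H.ip γ.1 γ.1 :=
  ip_expand _ _ (hs.mul_eq μ ν) γ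

theorem Strong.m_trivial (hs : H.Strong) (γ : H.Character) :
    H.ip γ.1 γ.1 = (hs.m γ (conjChar γ) H.trivialChar : ℂ) * (H.totalWeight : ℂ) := by
  have h := hs.m_ip γ (conjChar γ) H.trivialChar
  have e1 : H.ip H.trivialChar.1 (fun a => γ.1 a * (conjChar γ).1 a) = H.ip γ.1 γ.1 := by
    unfold ip trivialChar conjChar
    refine Finset.sum_congr rfl fun a _ => ?_
    simp only [map_one]
    ring
  have e2 : H.ip H.trivialChar.1 H.trivialChar.1 = (H.totalWeight : ℂ) := by
    unfold ip trivialChar totalWeight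
    simp
  rw [e1, e2] at h
  exact h

theorem Strong.rev_aux (hs : H.Strong) (μ ν γ : H.Character) :
    (hs.m μ ν γ : ℂ) * hs.m γ (conjChar γ) H.trivialChar * H.totalWeight
      = ∑ a, (H.weight a : ℂ) * (μ.1 a * ν.1 a * conj (γ.1 a)) := by
  rw [mul_assoc, ← hs.m_trivial, ← hs.m_ip]
  unfold ip
  exact Finset.sum_congr rfl fun a _ => by ring

theorem Strong.comm (hs : H.Strong) (μ ν γ : H.Character) : hs.m μ ν γ = hs.m ν μ γ :=
  hs.m_eq μ ν _ (fun a => by rw [mul_comm]; exact hs.mul_eq ν μ a) γ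

theorem Strong.rev (hs : H.Strong) (μ ν γ : H.Character) :
    hs.m μ ν γ * hs.m γ (conjChar γ) H.trivialChar
      = hs.m (conjChar μ) γ ν * hs.m ν (conjChar ν) H.trivialChar := by
  have h1 := congrArg conj (hs.rev_aux μ ν γ)
  have h2 := hs.rev_aux (conjChar μ) γ ν
  have h3 : conj (∑ a, (H.weight a : ℂ) * (μ.1 a * ν.1 a * conj (γ.1 a)))
      = ∑ a, (H.weight a : ℂ) * ((conjChar μ).1 a * γ.1 a * conj (ν.1 a)) := by
    rw [map_sum]
    refine Finset.sum_congr rfl fun a _ => ?_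
    simp only [map_mul, Complex.conj_ofReal, Complex.conj_conj, conjChar]
    ring
  rw [h3, ← h2] at h1
  simp only [map_mul, Complex.conj_ofReal] at h1
  have hw : (H.totalWeight : ℂ) ≠ 0 := by exact_mod_cast H.totalWeight_pos.ne'
  exact_mod_cast mul_right_cancel₀ hw h1

variable (H)

/-- The dual (character) hypergroup `T*` of a strong hypergroup: the product is the pointwise
product of functions, the identity is the trivial character, the involution is complex
conjugation. -/
def dual (hs : H.Strong) : Hypergroup H.Character where
  one := H.trivialChar
  bar := conjChar
  n := hs.m
  nonneg := hs.m_nonneg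
  comm := hs.comm
  assoc := by
    intro μ ν ρ d
    refine coef_ext (fun d => ∑ e, hs.m μ ν e * hs.m e ρ d)
      (fun d => ∑ e, hs.m ν ρ e * hs.m μ e d) (fun a => ?_) d
    have h1 : ∑ γ : H.Character, ((∑ e, hs.m μ ν e * hs.m e ρ γ : ℝ) : ℂ) * γ.1 a
        = μ.1 a * ν.1 a * ρ.1 a := by
      rw [hs.mul_eq μ ν a, Finset.sum_mul]
      push_cast
      simp only [Finset.sum_mul]
      rw [Finset.sum_comm]
      refine Finset.sum_congr rfl fun e _ => ?_
      rw [mul_assoc, hs.mul_eq e ρ a, Finset.mul_sum]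
      exact Finset.sum_congr rfl fun γ _ => by ring
    have h2 : ∑ γ : H.Character, ((∑ e, hs.m ν ρ e * hs.m μ e γ : ℝ) : ℂ) * γ.1 a
        = μ.1 a * (ν.1 a * ρ.1 a) := by
      rw [hs.mul_eq ν ρ a, Finset.mul_sum]
      push_cast
      simp only [Finset.sum_mul]
      rw [Finset.sum_comm]
      refine Finset.sum_congr rfl fun e _ => ?_
      rw [mul_left_comm, hs.mul_eq μ e a, Finset.mul_sum]
      exact Finset.sum_congr rfl fun γ _ => by ring
    rw [h1, h2, mul_assoc]
  one_mul := by
    classical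
    intro μ γ
    refine (hs.m_eq H.trivialChar μ (fun γ => if γ = μ then 1 else 0) (fun a => ?_) γ).trans ?_
    · rw [Finset.sum_eq_single μ (fun c _ hc => by rw [if_neg hc]; simp)
        (fun h => absurd (Finset.mem_univ _) h), if_pos rfl, Complex.ofReal_one]
      rfl
    · congr
  bar_bar := conjChar_conjChar
  n_bar := by
    intro μ ν γ
    refine (hs.m_eq (conjChar μ) (conjChar ν) (fun γ => hs.m μ ν (conjChar γ))
      (fun a => ?_) (conjChar γ)).trans (by simp only [conjChar_conjChar])
    have h := congrArg conj (hs.mul_eq μ ν a)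
    rw [map_mul, map_sum] at h
    refine h.trans ?_
    refine Fintype.sum_equiv ⟨conjChar, conjChar, conjChar_conjChar, conjChar_conjChar⟩ _ _
      fun γ => ?_
    simp only [Equiv.coe_fn_mk, conjChar_conjChar, map_mul, Complex.conj_ofReal]
    rfl
  anti := by
    intro μ ν
    have h := hs.m_ip μ ν H.trivialChar
    have e1 : H.ip H.trivialChar.1 (fun a => μ.1 a * ν.1 a) = H.ip (conjChar μ).1 ν.1 := by
      unfold ip trivialChar conjChar
      refine Finset.sum_congr rfl fun a _ => ?_
      simp only [map_one, Complex.conj_conj]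
      ring
    rw [e1] at h
    constructor
    · intro hne
      by_contra hn
      rw [H.ip_ne (Ne.symm hn)] at h
      rcases mul_eq_zero.1 h.symm with h0 | h0
      · exact hne (by exact_mod_cast h0)
      · exact H.ip_self_ne _ h0
    · rintro rfl h0
      rw [h0] at h
      refine H.ip_self_ne (conjChar μ) ?_
      simpa using h
  sum_one := by
    intro μ ν
    have h := hs.mul_eq μ ν H.one
    rw [μ.2.map_one, ν.2.map_one, mul_one] at h
    have h' : ∀ γ : H.Character, (hs.m μ ν γ : ℂ) * γ.1 H.one = hs.m μ ν γ := fun γ => by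
      rw [γ.2.map_one, mul_one]
    rw [Finset.sum_congr rfl fun γ _ => h' γ] at h
    exact_mod_cast h.symm
  rev_left := hs.rev
  rev_right := by
    intro μ ν γ
    rw [hs.comm μ ν γ, hs.comm γ (conjChar ν) μ]
    exact hs.rev ν μ γ

end Hypergroup

/-- A finite abelian strong hypergroup `T`. -/
structure StrongHypergroup where
  carrier : Type
  [fintype : Fintype carrier]
  str : Hypergroup carrier
  strong : str.Strong

namespace StrongHypergroup

attribute [instance] StrongHypergroup.fintype

variable (S : StrongHypergroup)

/-- The two standard bases: `Side false` is `T` (element basis), `Side true` is `T*`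
(character basis). Since `T**` is identified with `T`, the hypergroup `Side (!s)` is always the
dual of `Side s`. -/
def Side : Bool → Type
  | false => S.carrier
  | true => S.str.Character

instance instFintypeSide : ∀ s, Fintype (S.Side s)
  | false => S.fintype
  | true => inferInstanceAs (Fintype S.str.Character)

/-- The hypergroup structures of `T` and `T*`. -/
def hyp : ∀ s, Hypergroup (S.Side s)
  | false => S.str
  | true => S.str.dual S.strong

/-- `S.pairing s x y` is the value at `x` of the character labelled by `y`. A character
of `T` takes its own values; an element `a` of `T` is identified with the character
`χ ↦ conj (χ a)` of `T*`. -/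
def pairing : ∀ s, S.Side s → S.Side (!s) → ℂ
  | false => fun (a : S.carrier) (χ : S.str.Character) => χ.1 a
  | true => fun (χ : S.str.Character) (a : S.carrier) => conj (χ.1 a)

/-- `β` is the dual automorphism of `α`: `X_{β y} = X_y ∘ α`. -/
def IsDualAut {s : Bool} (α : (S.hyp s).Aut) (β : (S.hyp (!s)).Aut) : Prop :=
  ∀ x y, S.pairing s x (β.toEquiv y) = S.pairing s (α.toEquiv x) y

/-! ## Normalizer circuits with global Fourier transforms -/

/-- Normalizer gates that preserve the standard basis labelled by the current hypergroup
`Side s`: Pauli gates of type X and Z, and automorphism gates. -/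
inductive Gate (s : Bool) : Type
  | pauliX (a : S.Side s) (ha : (S.hyp s).IsInvertible a)
  | pauliZ (y : S.Side (!s)) (hy : (S.hyp (!s)).IsInvertible y)
  | aut (α : (S.hyp s).Aut)

/-- The linear action of a gate on amplitudes in the current standard basis: `X(a)|b⟩ = |ab⟩`,
`Z(y)|b⟩ = X_y(b)|b⟩`, `U_α|b⟩ = |α b⟩`. -/
def Gate.apply {S : StrongHypergroup} {s : Bool} :
    S.Gate s → (S.Side s → ℂ) → (S.Side s → ℂ)
  | .pauliX a _, ψ => fun c => ∑ b, ((S.hyp s).n a b c : ℂ) * ψ b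
  | .pauliZ y _, ψ => fun b => S.pairing s b y * ψ b
  | .aut α, ψ => fun c => ψ (α.toEquiv.symm c)

/-- The global quantum Fourier transform over `Side s`:
`|x⟩ ↦ ∑ y, √(w_x w_y / ϖ) X_y(x) |y⟩`. -/
def qft (s : Bool) (ψ : S.Side s → ℂ) : S.Side (!s) → ℂ :=
  fun y => ∑ x, (Real.sqrt ((S.hyp (!s)).weight y * (S.hyp s).weight x
    / (S.hyp (!s)).totalWeight) : ℂ) * S.pairing s x y * ψ x

/-- Circuits, listed in temporal order. `S.Circuit s s'` starts with the hypergroup `Side s`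
labelling the standard basis and ends with `Side s'`; a global Fourier transform replaces the
current hypergroup by its dual, other gates keep it. -/
inductive Circuit : Bool → Bool → Type
  | nil (s : Bool) : Circuit s s
  | gate {s s' : Bool} (g : S.Gate s) (C : Circuit s s') : Circuit s s'
  | qft {s s' : Bool} (C : Circuit (!s) s') : Circuit s s'

/-- The linear map implemented by a circuit. -/
def Circuit.apply {S : StrongHypergroup} :
    ∀ {s s' : Bool}, S.Circuit s s' → (S.Side s → ℂ) → (S.Side s' → ℂ)
  | _, _, .nil _, ψ => ψ
  | _, _, .gate g C, ψ => C.apply (g.apply ψ)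
  | s, _, .qft C, ψ => C.apply (S.qft s ψ)

open Classical in
/-- The probability of the outcome `z` when the circuit `C` runs on the basis state `|x⟩` and the
final state is measured in the standard basis labelled by the final hypergroup. -/
def Circuit.outcomeProb {S : StrongHypergroup} {s s' : Bool} (C : S.Circuit s s')
    (x : S.Side s) (z : S.Side s') : ℝ :=
  ‖C.apply (Pi.single x 1) z‖ ^ 2

/-- The distribution obtained by Fourier transforming the basis state `|y⟩` and measuring:
`w_x w_y |X_y(x)|² / ϖ_T`. -/
def fourierProb (s : Bool) (y : S.Side s) (x : S.Side (!s)) : ℝ :=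
  (S.hyp s).weight y * (S.hyp (!s)).weight x / S.str.totalWeight * ‖S.pairing s y x‖ ^ 2

end StrongHypergroup

/-! ## A probabilistic machine model with a step count -/

/-- Data are binary trees. -/
inductive Data : Type
  | nil
  | cons (a b : Data)

namespace Data

def size : Data → ℕ
  | nil => 1
  | cons a b => a.size + b.size + 1

def ofBool : Bool → Data
  | false => nil
  | true => cons nil nil

def ofBits : List Bool → Data
  | [] => nil
  | b :: l => cons (ofBool b) (ofBits l)

/-- The number `k` in unary. -/
def unary (k : ℕ) : Data := ofBits (List.replicate k true)

/-- Integers in binary, with a sign. -/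
def ofInt (m : ℤ) : Data := cons (ofBool (decide (m < 0))) (ofBits (Nat.bits m.natAbs))

end Data

/-- Programs transforming data: identity, constant, projections, pairing, composition
(`comp g f` is `g` after `f`), branching, while-loops and fair coin flips. -/
inductive Prog : Type
  | id
  | nil
  | hd
  | tl
  | pair (f g : Prog)
  | comp (g f : Prog)
  | ite (c f g : Prog)
  | loop (c f : Prog)
  | flip

/-- `Run ω p x i y j t`: with the sequence `ω` of coin tosses of which `i` are already used up,
the program `p` halts on input `x` with output `y` at cost `t`, after which `j` coin tosses are
used up. Every executed instruction costs the size of the data that it is applied to, so that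
costs agree up to a polynomial with the number of steps of a (probabilistic) Turing machine. -/
inductive Run (ω : ℕ → Bool) : Prog → Data → ℕ → Data → ℕ → ℕ → Prop
  | id (x i) : Run ω .id x i x i x.size
  | nil (x i) : Run ω .nil x i .nil i x.size
  | hd_nil (i) : Run ω .hd .nil i .nil i 1
  | hd_cons (a b i) : Run ω .hd (.cons a b) i a i (Data.cons a b).size
  | tl_nil (i) : Run ω .tl .nil i .nil i 1
  | tl_cons (a b i) : Run ω .tl (.cons a b) i b i (Data.cons a b).size
  | pair {f g x i y j s z k t} (hf : Run ω f x i y j s) (hg : Run ω g x j z k t) :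
      Run ω (.pair f g) x i (.cons y z) k (x.size + s + t)
  | comp {f g x i y j s z k t} (hf : Run ω f x i y j s) (hg : Run ω g y j z k t) :
      Run ω (.comp g f) x i z k (x.size + s + t)
  | ite_true {c f g x i a b j s y k t} (hc : Run ω c x i (.cons a b) j s)
      (hf : Run ω f x j y k t) : Run ω (.ite c f g) x i y k (x.size + s + t)
  | ite_false {c f g x i j s y k t} (hc : Run ω c x i .nil j s)
      (hg : Run ω g x j y k t) : Run ω (.ite c f g) x i y k (x.size + s + t)
  | loop_done {c f x i j s} (hc : Run ω c x i .nil j s) :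
      Run ω (.loop c f) x i x j (x.size + s)
  | loop_step {c f x i a b j s y k t z l u} (hc : Run ω c x i (.cons a b) j s)
      (hf : Run ω f x j y k t) (hl : Run ω (.loop c f) y k z l u) :
      Run ω (.loop c f) x i z l (x.size + s + t + u)
  | flip (x i) : Run ω .flip x i (Data.ofBool (ω i)) (i + 1) x.size

/-- Independent fair coin tosses. -/
def coins : MeasureTheory.Measure (ℕ → Bool) :=
  MeasureTheory.Measure.infinitePi fun _ => (PMF.uniformOfFintype Bool).toMeasure

/-- The program `p` computes, without using coins and at cost at most `B`, an output
satisfying `ok` from the input `x`. -/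
def Computes (p : Prog) (x : Data) (ok : Data → Prop) (B : ℕ) : Prop :=
  ∀ ω i, ∃ y t, Run ω p x i y i t ∧ ok y ∧ t ≤ B

/-- The probability that `p` halts on the input `x` with an output in `E`. -/
def outputProb (p : Prog) (x : Data) (E : Set Data) : ℝ :=
  coins.real {ω | ∃ y ∈ E, ∃ j t, Run ω p x 0 y j t}

/-- On the input `x` the program `p` always halts at cost at most `B`, and the law of its output
is within total variation distance `δ` of the distribution `q` on `X` (encoded by `enc`). -/
def Samples {X : Type} [Fintype X] (p : Prog) (x : Data) (enc : X → Data) (q : X → ℝ)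
    (δ : ℝ) (B : ℕ) : Prop :=
  (∀ ω, ∃ y j t, Run ω p x 0 y j t ∧ t ≤ B) ∧
    ∀ A : Finset X, |outputProb p x (enc '' (A : Set X)) - ∑ a ∈ A, q a| ≤ δ

/-- `y` is an integer `m` with `|m / 2^k - v| ≤ 2^{-k}`. -/
def ApproxReal (v : ℝ) (k : ℕ) (y : Data) : Prop :=
  ∃ m : ℤ, y = Data.ofInt m ∧ |(m : ℝ) / 2 ^ k - v| ≤ 1 / 2 ^ k

/-- `y` encodes approximations of the real and the imaginary part of `v`. -/
def ApproxComplex (v : ℂ) (k : ℕ) (y : Data) : Prop :=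
  ∃ a b : Data, y = Data.cons a b ∧ ApproxReal v.re k a ∧ ApproxReal v.im k b

/-! ## Computability assumptions -/

/-- How the members of a family of hypergroups are presented to a classical computer: each
member has a name, its elements and its characters are represented by bit strings, and some bit
strings describe automorphisms of `T` or of `T*`. -/
structure Presentation {ι : Type} (S : ι → StrongHypergroup) where
  name : ι → List Bool
  code : ∀ i s, (S i).Side s → List Bool
  autDesc : ∀ i s, List Bool → Option ((S i).hyp s).Aut

namespace Presentation

open Data Polynomial

variable {ι : Type} {S : ι → StrongHypergroup} (P : Presentation S)

/-- The member of the family, as an input. -/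
def nameData (i : ι) : Data := ofBits (P.name i)

/-- An element of `T` or of `T*`, as an input. -/
def enc (i : ι) (s : Bool) (x : (S i).Side s) : Data := ofBits (P.code i s x)

variable (S) in
/-- `log₂ |T|`. -/
def logCard (i : ι) : ℕ := Nat.log 2 (Fintype.card (S i).carrier)

/-- The hypergroups `T` (for `s = false`) or `T*` (for `s = true`) of the family are efficiently
computable: elements are uniquely represented by `polylog |T|` bits, there are polynomial-time
subroutines for the structure constants, and the product with an invertible element and the inverse
of an invertible element can be computed in polynomial time. -/
structure EfficientlyComputable (s : Bool) : Prop where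
  code_injective : ∀ i, Function.Injective (P.code i s)
  code_length : ∃ B : ℕ[X], ∀ i x, (P.code i s x).length ≤ B.eval (logCard S i)
  const : ∃ (p : Prog) (B : ℕ[X]), ∀ i a b c k,
    Computes p (cons (P.nameData i) (cons (P.enc i s a) (cons (P.enc i s b)
      (cons (P.enc i s c) (unary k)))))
      (ApproxReal (((S i).hyp s).n a b c) k) (B.eval (logCard S i + k))
  mul : ∃ (p : Prog) (B : ℕ[X]), ∀ i a b c,
    ((S i).hyp s).IsInvertible a → ((S i).hyp s).n a b c = 1 →
    Computes p (cons (P.nameData i) (cons (P.enc i s a) (P.enc i s b)))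
      (fun y => y = P.enc i s c) (B.eval (logCard S i))
  inv : ∃ (p : Prog) (B : ℕ[X]), ∀ i a, ((S i).hyp s).IsInvertible a →
    Computes p (cons (P.nameData i) (P.enc i s a))
      (fun y => y = P.enc i s (((S i).hyp s).bar a)) (B.eval (logCard S i))

/-- The family is doubly efficiently computable, where distributions are sampled with accuracy
`ε k` in time polynomial in `log |T|` and `k`. -/
structure DoublyEfficientlyComputable (ε : ℕ → ℝ≥0) : Prop where
  name_length : ∃ B : ℕ[X], ∀ i, (P.name i).length ≤ B.eval (logCard S i)
  /-- Both `T` and `T*` are efficiently computable. -/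
  efficient : ∀ s, P.EfficientlyComputable s
  /-- (i) Computable characters. -/
  characters : ∃ (p : Prog) (B : ℕ[X]), ∀ i (a : (S i).Side false) (μ : (S i).Side true) k,
    Computes p (cons (P.nameData i) (cons (P.enc i false a) (cons (P.enc i true μ) (unary k))))
      (ApproxComplex ((S i).pairing false a μ) k) (B.eval (logCard S i + k))
  /-- (ii) Fourier transforms of basis states can be sampled. -/
  sampling : ∀ s, ∃ (p : Prog) (B : ℕ[X]), ∀ i (y : (S i).Side s) k,
    Samples p (cons (P.nameData i) (cons (P.enc i s y) (unary k))) (P.enc i (!s))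
      ((S i).fourierProb s y) (ε k) (B.eval (logCard S i + k))
  /-- Described automorphisms can be computed. -/
  aut_eval : ∀ s, ∃ (p : Prog) (B : ℕ[X]), ∀ i d α x, P.autDesc i s d = some α →
    Computes p (cons (P.nameData i) (cons (ofBits d) (P.enc i s x)))
      (fun y => y = P.enc i s (α.toEquiv x)) (B.eval (logCard S i + d.length))
  /-- (iii) Inverses of automorphisms can be determined. -/
  aut_inv : ∀ s, ∃ (p : Prog) (B : ℕ[X]), ∀ i d α, P.autDesc i s d = some α →
    Computes p (cons (P.nameData i) (ofBits d))
      (fun y => ∃ d' β, y = ofBits d' ∧ P.autDesc i s d' = some β ∧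
        β.toEquiv = α.toEquiv.symm) (B.eval (logCard S i + d.length))
  /-- (iii) Dual automorphisms can be determined. -/
  aut_dual : ∀ s, ∃ (p : Prog) (B : ℕ[X]), ∀ i d α, P.autDesc i s d = some α →
    Computes p (cons (P.nameData i) (ofBits d))
      (fun y => ∃ d' β, y = ofBits d' ∧ P.autDesc i (!s) d' = some β ∧
        (S i).IsDualAut α β) (B.eval (logCard S i + d.length))

/-- `D` is a classical description of a gate: its type, and the bit string of the element, the
character or the automorphism. -/
inductive DescribesGate (i : ι) {s : Bool} : (S i).Gate s → Data → Prop
  | pauliX (a ha) :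
      DescribesGate i (.pauliX a ha) (cons (unary 1) (P.enc i s a))
  | pauliZ (y hy) :
      DescribesGate i (.pauliZ y hy) (cons (unary 2) (P.enc i (!s) y))
  | aut (α d) (h : P.autDesc i s d = some α) :
      DescribesGate i (.aut α) (cons (unary 3) (ofBits d))

/-- `D` is a classical description of a circuit: the list of the descriptions of its gates. -/
inductive Describes (i : ι) : ∀ {s s' : Bool}, (S i).Circuit s s' → Data → Prop
  | nil (s) : Describes i (.nil s) Data.nil
  | gate {s s' : Bool} {g : (S i).Gate s} {C : (S i).Circuit s s'} {G D : Data}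
      (hg : P.DescribesGate i g G) (hC : Describes i C D) :
      Describes i (.gate g C) (cons G D)
  | qft {s s' : Bool} {C : (S i).Circuit (!s) s'} {D : Data} (hC : Describes i C D) :
      Describes i (.qft C) (cons Data.nil D)

end Presentation

end HypergroupSim

end

/-!
A circuit of Pauli gates, automorphism gates and global Fourier transforms never leaves, up to a
global phase, a small set of states: the basis states `|x⟩` of the current basis, and the Fourier
transforms of the basis states `|y⟩` of the dual basis (`StrongHypergroup.Label.state`). On a basis
state, a Pauli gate of type X multiplies `x` by an invertible element, one of type Z is a phase, and
an automorphism gate evaluates the automorphism at `x`. On the Fourier transform of `|y⟩` the Pauli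
gates exchange their roles: type X is a phase, type Z multiplies `y` by the inverse of its
character, and an automorphism `α` acts on `y` by the dual of `α⁻¹`. A Fourier transform passes
from one kind of state to the other and keeps the element (`StrongHypergroup.Label.qft_state`), so
the element remains all the time in the hypergroup in which it started. A classical program can
therefore track the label. If it ends with a basis state it returns the label, and if it ends with a
Fourier transform it calls the given sampler once, which has accuracy `ε k`; no other step makes an
error.

The analytic input is that the Fourier transform inverts its dual, which amounts to the two
orthogonality relations between characters. The second one
(`Hypergroup.sum_character_mul_conj`) expresses that characters span all functions. The translation
operators commute, and the adjoint of translation by `a` is translation by `ā`, so the orthogonal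
complement of the characters is invariant under translations; were it not zero, it would contain a
common eigenvector, which has to be a multiple of a character
(`Hypergroup.exists_character_of_eigenvector`).

On the machine side, the label has polynomial size at every step, because every element has a short
representation, so the costs of the steps do not compound. Descriptions of automorphisms are only
passed along the chain "invert, dualize, evaluate" within one step, and they are bounded by the cost
of producing them (`Run.output_size_le`). Coins are tossed only in the final sampling, because a
run that does not toss coins is the same for all coin sequences (`Run.of_no_coins`).
-/

noncomputable section

namespace HypergroupSim

/-! ### Common eigenvectors of commuting operators -/

theorem exists_common_eigenvector {V ι : Type*} [AddCommGroup V] [Module ℂ V]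
    [FiniteDimensional ℂ V] [Finite ι] (f : ι → Module.End ℂ V)
    (hf : ∀ i j, Commute (f i) (f j)) (W : Submodule ℂ V) (hW : W ≠ ⊥)
    (hinv : ∀ i, ∀ v ∈ W, f i v ∈ W) :
    ∃ v ∈ W, v ≠ 0 ∧ ∀ i, ∃ μ : ℂ, f i v = μ • v := by
  classical
  cases nonempty_fintype ι
  have key : ∀ s : Finset ι, ∃ U ≤ W, U ≠ ⊥ ∧ (∀ i, ∀ v ∈ U, f i v ∈ U) ∧
      ∀ i ∈ s, ∃ μ : ℂ, ∀ v ∈ U, f i v = μ • v := by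
    intro s
    induction s using Finset.induction_on with
    | empty => exact ⟨W, le_rfl, hW, hinv, by simp⟩
    | insert j s _ ih =>
      obtain ⟨U, hUW, hU, hUinv, hUs⟩ := ih
      have : Nontrivial U := Submodule.nontrivial_iff_ne_bot.2 hU
      obtain ⟨μ, hμ⟩ := Module.End.exists_eigenvalue ((f j).restrict (hUinv j))
      obtain ⟨v, hv⟩ := hμ.exists_hasEigenvector
      have hv1 : f j v = μ • (v : V) := by
        simpa using congrArg Subtype.val hv.apply_eq_smul
      refine ⟨U ⊓ (f j).eigenspace μ, inf_le_left.trans hUW, ?_, ?_, ?_⟩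
      · rw [Submodule.ne_bot_iff]
        exact ⟨v, ⟨v.2, Module.End.mem_eigenspace_iff.2 hv1⟩, fun h => hv.2 (Subtype.ext h)⟩
      · rintro i u ⟨hu, hu'⟩
        refine ⟨hUinv i u hu, Module.End.mem_eigenspace_iff.2 ?_⟩
        have hc : f j (f i u) = f i (f j u) := congrArg (fun g => g u) (hf j i).eq
        rw [hc, Module.End.mem_eigenspace_iff.1 hu', map_smul]
      · intro i hi
        rcases Finset.mem_insert.1 hi with rfl | hi
        · exact ⟨μ, fun u hu => Module.End.mem_eigenspace_iff.1 hu.2⟩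
        · obtain ⟨ν, hν⟩ := hUs i hi
          exact ⟨ν, fun u hu => hν u hu.1⟩
  obtain ⟨U, hUW, hU, -, hUs⟩ := key Finset.univ
  obtain ⟨v, hv, hv0⟩ := (Submodule.ne_bot_iff U).1 hU
  exact ⟨v, hUW hv, hv0, fun i => (hUs i (Finset.mem_univ i)).imp fun μ h => h v hv⟩

namespace Hypergroup

variable {T : Type} [Fintype T] (H : Hypergroup T)

/-! ### Completeness of the characters -/

/-- The operator `f ↦ f(a ·)` of translation by `a`, where `f` is extended linearly to the
hypergroup algebra. The characters are its normalized common eigenvectors. -/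
def translate (a : T) : Module.End ℂ (T → ℂ) where
  toFun f b := ∑ c, (H.n a b c : ℂ) * f c
  map_add' f g := by
    funext b
    simp [mul_add, Finset.sum_add_distrib]
  map_smul' z f := by
    funext b
    simp only [Pi.smul_apply, smul_eq_mul, RingHom.id_apply, Finset.mul_sum]
    exact Finset.sum_congr rfl fun c _ => by ring

theorem translate_apply (a : T) (f : T → ℂ) (b : T) :
    H.translate a f b = ∑ c, (H.n a b c : ℂ) * f c := rfl

theorem translate_translate (a b : T) (f : T → ℂ) (x : T) :
    H.translate a (H.translate b f) x = ∑ d, ((∑ c, H.n a x c * H.n c b d : ℝ) : ℂ) * f d := by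
  simp only [translate_apply, Finset.mul_sum]
  rw [Finset.sum_comm]
  refine Finset.sum_congr rfl fun d _ => ?_
  push_cast
  rw [Finset.sum_mul]
  exact Finset.sum_congr rfl fun c _ => by rw [H.comm b c]; ring

theorem translate_commute (a b : T) : Commute (H.translate a) (H.translate b) := by
  refine LinearMap.ext fun f => funext fun x => ?_
  change H.translate a (H.translate b f) x = H.translate b (H.translate a f) x
  rw [translate_translate, translate_translate]
  refine Finset.sum_congr rfl fun d _ => ?_
  rw [H.assoc]
  congr 2
  exact Finset.sum_congr rfl fun e _ => by rw [H.comm x b, H.comm a e]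

/-- Translation by `b̄` is the adjoint of translation by `b`, by reversibility. -/
theorem ip_translate (b : T) (f g : T → ℂ) :
    H.ip f (H.translate b g) = H.ip (H.translate (H.bar b) f) g := by
  unfold ip
  simp only [translate_apply, map_sum, map_mul, Complex.conj_ofReal, Finset.mul_sum,
    Finset.sum_mul]
  rw [Finset.sum_comm]
  refine Finset.sum_congr rfl fun c _ => Finset.sum_congr rfl fun a _ => ?_
  have h : (H.weight a : ℂ) * H.n b a c = H.weight c * H.n (H.bar b) c a := by
    exact_mod_cast H.weight_rev b a c
  linear_combination (conj (f a) * g c) * h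

theorem ip_smul_left (z : ℂ) (f g : T → ℂ) : H.ip (z • f) g = conj z * H.ip f g := by
  simp only [ip, Finset.mul_sum, Pi.smul_apply, smul_eq_mul, map_mul]
  exact Finset.sum_congr rfl fun a _ => by ring

theorem ip_smul_right (z : ℂ) (f g : T → ℂ) : H.ip f (z • g) = z * H.ip f g := by
  simp only [ip, Finset.mul_sum, Pi.smul_apply, smul_eq_mul]
  exact Finset.sum_congr rfl fun a _ => by ring

theorem ip_add_right (f g h : T → ℂ) : H.ip f (g + h) = H.ip f g + H.ip f h := by
  simp only [ip, Pi.add_apply, mul_add, Finset.sum_add_distrib]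

theorem ip_self_eq_zero {f : T → ℂ} (h : H.ip f f = 0) : f = 0 := by
  rw [ip_self] at h
  have h' : ∑ a, H.weight a * ‖f a‖ ^ 2 = 0 := by exact_mod_cast h
  rw [Finset.sum_eq_zero_iff_of_nonneg
    fun a _ => mul_nonneg (H.weight_pos a).le (sq_nonneg _)] at h'
  funext a
  simpa [(H.weight_pos a).ne'] using h' a (Finset.mem_univ a)

theorem translate_character {χ : T → ℂ} (h : H.IsCharacter χ) (a : T) :
    H.translate a χ = χ a • χ :=
  funext fun b => (h.mul a b).symm

theorem mul_one_eq (a c : T) [Decidable (c = a)] : H.n a H.one c = if c = a then 1 else 0 := by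
  rw [H.comm, H.one_mul]
  congr

theorem translate_one (a : T) (f : T → ℂ) : H.translate a f H.one = f a := by
  classical
  rw [translate_apply, Finset.sum_eq_single a]
  · simp [mul_one_eq]
  · intro c _ hc
    simp [mul_one_eq, hc]
  · simp

/-- A common eigenvector `v` of all translations is a multiple of a character: its value at `a`
is the eigenvalue of translation by `a` times `v(1)`, and translation by `ā` is the adjoint of
translation by `a`. -/
theorem exists_character_of_eigenvector {v : T → ℂ} (hv : v ≠ 0)
    (h : ∀ a, ∃ μ : ℂ, H.translate a v = μ • v) :
    ∃ (χ : H.Character) (z : ℂ), v = z • χ.1 := by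
  choose μ hμ using h
  have hval : ∀ a, v a = μ a * v H.one := fun a => by
    rw [← H.translate_one a v, hμ, Pi.smul_apply, smul_eq_mul]
  have h1 : v H.one ≠ 0 := fun h0 => hv (funext fun a => by rw [hval, h0]; simp)
  have hvv : H.ip v v ≠ 0 := fun h => hv (H.ip_self_eq_zero h)
  refine ⟨⟨μ, fun h0 => hv (funext fun a => by rw [hval, h0]; simp), fun a b => ?_, fun a => ?_⟩,
    v H.one, funext fun a => ?_⟩
  · have := congrFun (hμ a) b
    rw [translate_apply, Pi.smul_apply, smul_eq_mul, hval b] at this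
    refine mul_right_cancel₀ h1 ?_
    rw [mul_assoc, ← this, Finset.sum_mul]
    exact Finset.sum_congr rfl fun c _ => by rw [hval c]; ring
  · have := H.ip_translate (H.bar a) v v
    rw [H.bar_bar, hμ, hμ, ip_smul_right, ip_smul_left] at this
    exact mul_right_cancel₀ hvv this
  · rw [hval a, Pi.smul_apply, smul_eq_mul, mul_comm]

/-- Only zero is orthogonal to all characters: otherwise the orthogonal complement, which is
invariant under translations, would contain a common eigenvector, hence a character. -/
theorem eq_zero_of_ip_character {f : T → ℂ} (hf : ∀ χ : H.Character, H.ip χ.1 f = 0) :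
    f = 0 := by
  let W : Submodule ℂ (T → ℂ) :=
    { carrier := {g | ∀ χ : H.Character, H.ip χ.1 g = 0}
      add_mem' := fun {g h} hg hh χ => by rw [ip_add_right, hg χ, hh χ, add_zero]
      zero_mem' := fun χ => by simp [ip]
      smul_mem' := fun z g hg χ => by rw [ip_smul_right, hg χ, mul_zero] }
  by_contra h0
  have hW : W ≠ ⊥ := (Submodule.ne_bot_iff W).2 ⟨f, hf, h0⟩
  obtain ⟨v, hv, hv0, he⟩ := exists_common_eigenvector H.translate H.translate_commute W hW
    (fun a g hg χ => by
      rw [ip_translate, H.translate_character χ.2, ip_smul_left, hg χ, mul_zero])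
  obtain ⟨χ, z, rfl⟩ := H.exists_character_of_eigenvector hv0 he
  refine hv0 (H.ip_self_eq_zero ?_)
  rw [ip_smul_left, hv χ, mul_zero]

theorem bar_one : H.bar H.one = H.one :=
  ((H.anti H.one H.one).1 (by classical simp [H.one_mul])).symm

theorem weight_one : H.weight H.one = 1 := by
  classical
  simp [weight, H.one_mul, H.bar_one]

/-- The first orthogonality relation, with the norm expressed by the weight in the dual. -/
theorem ip_character [DecidableEq H.Character] (hs : H.Strong) (μ ν : H.Character) :
    H.ip μ.1 ν.1 = if ν = μ then (H.totalWeight : ℂ) / (H.dual hs).weight μ else 0 := by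
  split_ifs with h
  · subst h
    rw [hs.m_trivial]
    have : (H.dual hs).weight ν = 1 / hs.m ν (conjChar ν) H.trivialChar := rfl
    rw [this]
    push_cast
    rw [div_div_eq_mul_div, div_one, mul_comm]
  · exact H.ip_ne (Ne.symm h)

/-- The second orthogonality relation: the defect of the expansion of the indicator function of
`b` in characters is orthogonal to every character, hence zero. -/
theorem sum_character_mul_conj [DecidableEq T] (hs : H.Strong) (a b : T) :
    ∑ χ : H.Character, ((H.dual hs).weight χ : ℂ) * (χ.1 a * conj (χ.1 b))
      = if b = a then (H.totalWeight : ℂ) / H.weight a else 0 := by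
  classical
  have hϖ : (H.totalWeight : ℂ) ≠ 0 := by exact_mod_cast H.totalWeight_pos.ne'
  have hb : (H.weight b : ℂ) ≠ 0 := by exact_mod_cast (H.weight_pos b).ne'
  have hipb : ∀ χ : H.Character,
      H.ip χ.1 (Pi.single b 1) = H.weight b * conj (χ.1 b) := fun χ => by
    unfold ip
    rw [Finset.sum_eq_single b (fun c _ hc => by simp [hc]) (by simp)]
    simp
  have key : Pi.single b 1 + (-1 : ℂ) • (fun a => ∑ χ : H.Character,
      ((H.weight b : ℂ) * conj (χ.1 b) * (H.dual hs).weight χ / H.totalWeight) * χ.1 a)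
      = (0 : T → ℂ) := by
    refine H.eq_zero_of_ip_character fun χ => ?_
    have hχ : ((H.dual hs).weight χ : ℂ) ≠ 0 := by
      exact_mod_cast ((H.dual hs).weight_pos χ).ne'
    rw [ip_add_right, ip_smul_right, H.ip_sum Finset.univ χ.1 _ (fun χ : H.Character => χ.1),
      hipb]
    simp only [H.ip_character hs]
    rw [Finset.sum_eq_single χ (fun ψ _ hψ => by rw [if_neg hψ, mul_zero]) (by simp),
      if_pos rfl]
    field_simp
    ring
  have h := congrFun key a
  simp only [Pi.add_apply, Pi.smul_apply, smul_eq_mul, Pi.zero_apply, Pi.single_apply] at h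
  have h' : ∑ χ : H.Character, ((H.dual hs).weight χ : ℂ) * (χ.1 a * conj (χ.1 b))
      = H.totalWeight / H.weight b * ∑ χ : H.Character,
      ((H.weight b : ℂ) * conj (χ.1 b) * (H.dual hs).weight χ / H.totalWeight) * χ.1 a := by
    rw [Finset.mul_sum]
    refine Finset.sum_congr rfl fun χ _ => ?_
    field_simp
  rw [h', show ∑ χ : H.Character, ((H.weight b : ℂ) * conj (χ.1 b) * (H.dual hs).weight χ
    / H.totalWeight) * χ.1 a = if a = b then 1 else 0 by linear_combination -h]
  by_cases hab : b = a
  · simp [hab]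
  · simp [hab, Ne.symm hab]

/-- The second orthogonality relation at `a = b = 1`. -/
theorem totalWeight_dual (hs : H.Strong) : (H.dual hs).totalWeight = H.totalWeight := by
  classical
  have h := H.sum_character_mul_conj hs H.one H.one
  simp only [fun χ : H.Character => χ.2.map_one, if_true, weight_one, map_one, mul_one,
    Complex.ofReal_one, div_one] at h
  exact_mod_cast h

/-! ### Invertible elements -/

variable {H}

theorem IsInvertible.n_bar_self {a : T} (ha : H.IsInvertible a) : H.n a (H.bar a) H.one = 1 := by
  obtain ⟨b, hb⟩ := ha
  have : b = H.bar a := (H.anti a b).1 (by rw [hb]; exact one_ne_zero)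
  rwa [← this]

/-- The constants `n_{ab}^d` sum to one, so a constant equal to one is the only nonzero one. -/
theorem n_eq_of_eq_one [DecidableEq T] {a b c : T} (h : H.n a b c = 1) (d : T) :
    H.n a b d = if d = c then 1 else 0 := by
  split_ifs with hd
  · rw [hd, h]
  · have h1 := H.sum_one a b
    rw [← Finset.add_sum_erase _ _ (Finset.mem_univ c), h] at h1
    have h2 : ∑ x ∈ Finset.univ.erase c, H.n a b x = 0 := by linarith
    exact (Finset.sum_eq_zero_iff_of_nonneg fun x _ => H.nonneg a b x).1 h2 d
      (Finset.mem_erase.2 ⟨hd, Finset.mem_univ d⟩)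

theorem IsInvertible.bar {a : T} (ha : H.IsInvertible a) : H.IsInvertible (H.bar a) :=
  ⟨a, by rw [H.comm]; exact ha.n_bar_self⟩

/-- If `c` occurs in the product `a b` and `a` is invertible, then `ā c = b`. -/
theorem IsInvertible.n_bar_eq_one {a b c : T} (ha : H.IsInvertible a) (h : H.n a b c ≠ 0) :
    H.n (H.bar a) c b = 1 := by
  classical
  have hz : ∀ d, d ≠ b → H.n (H.bar a) c d = 0 := by
    intro d hd
    have h1 := H.assoc (H.bar a) a b d
    have h0 : ∑ e, H.n (H.bar a) a e * H.n e b d = 0 := by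
      refine Finset.sum_eq_zero fun e _ => ?_
      rw [n_eq_of_eq_one ((H.comm _ _ _).trans ha.n_bar_self)]
      split_ifs with he
      · rw [he, H.one_mul, if_neg hd, mul_zero]
      · rw [zero_mul]
    rw [h0, eq_comm, Finset.sum_eq_zero_iff_of_nonneg
      fun e _ => mul_nonneg (H.nonneg _ _ _) (H.nonneg _ _ _)] at h1
    exact (mul_eq_zero.1 (h1 c (Finset.mem_univ c))).resolve_left h
  have h1 := H.sum_one (H.bar a) c
  rwa [Finset.sum_eq_single b (fun d _ hd => hz d hd) (by simp)] at h1

theorem IsInvertible.n_bar_eq_one_iff {a b c : T} (ha : H.IsInvertible a) :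
    H.n a b c = 1 ↔ H.n (H.bar a) c b = 1 := by
  refine ⟨fun h => ha.n_bar_eq_one (by rw [h]; exact one_ne_zero), fun h => ?_⟩
  have := ha.bar.n_bar_eq_one (by rw [h]; exact one_ne_zero)
  rwa [H.bar_bar] at this

theorem IsInvertible.exists_mul {a : T} (ha : H.IsInvertible a) (b : T) :
    ∃ c, H.n a b c = 1 := by
  have : ∃ c, H.n a b c ≠ 0 := by
    by_contra! h
    have := H.sum_one a b
    simp [h] at this
  obtain ⟨c, hc⟩ := this
  exact ⟨c, ha.n_bar_eq_one_iff.2 (ha.n_bar_eq_one hc)⟩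

theorem IsInvertible.weight_eq {a b c : T} (ha : H.IsInvertible a) (h : H.n a b c = 1) :
    H.weight c = H.weight b := by
  have := H.weight_rev a b c
  rw [h, ha.n_bar_eq_one_iff.1 h] at this
  linarith

theorem IsCharacter.mul_of_eq_one {χ : T → ℂ} (hχ : H.IsCharacter χ) {a b c : T}
    (h : H.n a b c = 1) : χ a * χ b = χ c := by
  classical
  rw [hχ.mul]
  rw [Finset.sum_eq_single c (fun d _ hd => by simp [n_eq_of_eq_one h, hd]) (by simp), h]
  simp

theorem IsCharacter.norm_of_invertible {χ : T → ℂ} (hχ : H.IsCharacter χ) {a : T}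
    (ha : H.IsInvertible a) : ‖χ a‖ = 1 := by
  have h := hχ.mul_of_eq_one ha.n_bar_self
  rw [hχ.bar, hχ.map_one, Complex.mul_conj'] at h
  have h2 : ‖χ a‖ ^ 2 = 1 := by exact_mod_cast h
  exact (pow_eq_one_iff_of_nonneg (norm_nonneg _) two_ne_zero).1 h2

theorem IsCharacter.conjugate {χ : T → ℂ} (hχ : H.IsCharacter χ) :
    H.IsCharacter fun a => conj (χ a) :=
  (conjChar ⟨χ, hχ⟩).2

theorem Aut.map_one (α : H.Aut) : α.toEquiv H.one = H.one := by
  classical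
  have h2 := α.map_n H.one (α.toEquiv.symm H.one) H.one
  rw [Equiv.apply_symm_apply, H.mul_one_eq, H.one_mul] at h2
  by_contra h
  have h3 : α.toEquiv.symm H.one ≠ H.one := fun h' => h (by rw [← h', Equiv.apply_symm_apply, h'])
  rw [if_pos rfl, if_neg (Ne.symm h3)] at h2
  exact one_ne_zero h2

theorem Aut.weight_eq (α : H.Aut) (a : T) : H.weight (α.toEquiv a) = H.weight a := by
  unfold weight
  have := α.map_n a (H.bar a) H.one
  rw [α.map_bar, α.map_one] at this
  rw [this]

end Hypergroup

namespace StrongHypergroup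

open Hypergroup

variable (S : StrongHypergroup)

/-! ### The pairing between the two bases -/

theorem isCharacter_eval (a : S.carrier) : (S.str.dual S.strong).IsCharacter fun χ => χ.1 a :=
  ⟨fun h => one_ne_zero (α := ℂ) (congrFun h S.str.trivialChar),
    fun μ ν => S.strong.mul_eq μ ν a, fun _ => rfl⟩

theorem isCharacter_pairing_left : ∀ (s : Bool) (y : S.Side (!s)),
    (S.hyp s).IsCharacter fun x => S.pairing s x y
  | false, y => Subtype.property (p := S.str.IsCharacter) y
  | true, a => (S.isCharacter_eval a).conjugate

theorem isCharacter_pairing_right : ∀ (s : Bool) (x : S.Side s),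
    (S.hyp (!s)).IsCharacter fun y => S.pairing s x y
  | false, a => S.isCharacter_eval a
  | true, χ => (S.isCharacter_pairing_left false χ).conjugate

theorem totalWeight_hyp : ∀ s, (S.hyp s).totalWeight = S.str.totalWeight
  | false => rfl
  | true => S.str.totalWeight_dual S.strong

theorem sum_pairing_mul_conj : ∀ (s : Bool) [DecidableEq (S.Side (!s))] (z y : S.Side (!s)),
    ∑ x, ((S.hyp s).weight x : ℂ) * (S.pairing s x z * conj (S.pairing s x y))
      = if z = y then (S.str.totalWeight : ℂ) / (S.hyp (!s)).weight y else 0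
  | false, inst, z, y => by
    have h := @ip_character _ _ S.str inst S.strong y z
    refine Eq.trans (Finset.sum_congr rfl fun x _ => ?_) (h.trans ?_)
    · rw [mul_comm (S.pairing false x z)]
      rfl
    · rfl
  | true, inst, z, y => by
    have h := @sum_character_mul_conj _ _ S.str inst S.strong y z
    refine Eq.trans (Finset.sum_congr rfl fun x _ => ?_) (h.trans ?_)
    · simp only [pairing, Complex.conj_conj]
      rw [mul_comm (conj _)]
      rfl
    · rfl

/-! ### States reached by normalizer circuits -/

/-- The labels of the states that a circuit visits while the standard basis is labelled by
`Side s`: basis states, and Fourier transforms of basis states of the dual side. -/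
inductive Label (s : Bool) : Type
  | basis (x : S.Side s)
  | fourier (y : S.Side (!s))

variable {S}

namespace Label

open Classical in
/-- The state with a given label. The Fourier transform of `|y⟩` is expressed by the pairing that
has the current side on the left, which conjugates its values. -/
def state {s : Bool} : S.Label s → S.Side s → ℂ
  | basis x => Pi.single x 1
  | fourier y => fun b =>
      (Real.sqrt ((S.hyp (!s)).weight y * (S.hyp s).weight b / S.str.totalWeight) : ℂ)
        * conj (S.pairing s b y)

/-- The effect of the Fourier transform on labels: the element is kept. -/
def toggle : ∀ {s : Bool}, S.Label s → S.Label (!s)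
  | false, basis x => .fourier (show S.Side (!!false) from x)
  | true, basis x => .fourier (show S.Side (!!true) from x)
  | _, fourier y => .basis y

/-- The Fourier transform acts on labels by `toggle`. For Fourier transformed labels this is the
orthogonality of the columns of the pairing; because of the conjugation in
`StrongHypergroup.pairing`, two transforms compose to the identity rather than to `bar`. -/
theorem qft_state {s : Bool} (ℓ : S.Label s) : S.qft s ℓ.state = ℓ.toggle.state := by
  classical
  cases ℓ with
  | basis x =>
    have h : ∀ y, S.qft s (basis x).state y = (Real.sqrt ((S.hyp (!s)).weight y *
        (S.hyp s).weight x / S.str.totalWeight) : ℂ) * S.pairing s x y := fun y => by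
      unfold qft
      rw [Finset.sum_eq_single x (fun b _ hb => by simp [state, hb]) (by simp),
        S.totalWeight_hyp]
      simp [state]
    funext y
    rw [h]
    rw [mul_comm ((S.hyp (!s)).weight y)]
    cases s
    · exact congrArg _ (Complex.conj_conj _).symm
    · rfl
  | fourier y =>
    funext z
    have hϖ := S.str.totalWeight_pos
    have hz := (S.hyp (!s)).weight_pos z
    have hy := (S.hyp (!s)).weight_pos y
    have h : S.qft s (fourier y).state z
        = (Real.sqrt ((S.hyp (!s)).weight z * (S.hyp (!s)).weight y)
          / S.str.totalWeight : ℝ) * ∑ x, ((S.hyp s).weight x : ℂ)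
          * (S.pairing s x z * conj (S.pairing s x y)) := by
      unfold qft
      rw [Finset.mul_sum]
      refine Finset.sum_congr rfl fun x _ => ?_
      have hx := (S.hyp s).weight_pos x
      have e : Real.sqrt ((S.hyp (!s)).weight z * (S.hyp s).weight x / S.str.totalWeight)
          * Real.sqrt ((S.hyp (!s)).weight y * (S.hyp s).weight x / S.str.totalWeight)
          = Real.sqrt ((S.hyp (!s)).weight z * (S.hyp (!s)).weight y)
            / S.str.totalWeight * (S.hyp s).weight x := by
        rw [← Real.sqrt_mul (by positivity), show
          (S.hyp (!s)).weight z * (S.hyp s).weight x / S.str.totalWeight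
            * ((S.hyp (!s)).weight y * (S.hyp s).weight x / S.str.totalWeight)
          = (S.hyp (!s)).weight z * (S.hyp (!s)).weight y
            * ((S.hyp s).weight x / S.str.totalWeight) ^ 2 by ring,
          Real.sqrt_mul (by positivity), Real.sqrt_sq (by positivity)]
        ring
      have e' := congrArg (fun r : ℝ => (r : ℂ)) e
      push_cast at e'
      rw [S.totalWeight_hyp]
      simp only [state]
      push_cast
      linear_combination S.pairing s x z * conj (S.pairing s x y) * e'
    rw [h, S.sum_pairing_mul_conj]
    by_cases hzy : z = y
    · subst hzy
      rw [if_pos rfl, Real.sqrt_mul_self hz.le]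
      simp only [toggle, state, Pi.single_eq_same]
      push_cast
      have h1 : (S.str.totalWeight : ℂ) ≠ 0 := by exact_mod_cast hϖ.ne'
      have h2 : ((S.hyp (!s)).weight z : ℂ) ≠ 0 := by exact_mod_cast hz.ne'
      field_simp
    · rw [if_neg hzy]
      simp [toggle, state, hzy]

variable {s : Bool}

theorem pauliX_basis {a : S.Side s} (ha : (S.hyp s).IsInvertible a) {x z : S.Side s}
    (h : (S.hyp s).n a x z = 1) :
    (Gate.pauliX a ha).apply (basis x).state = (basis z).state := by
  classical
  funext c
  simp only [Gate.apply, state]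
  rw [Finset.sum_eq_single x (fun b _ hb => by simp [hb]) (by simp), n_eq_of_eq_one h]
  by_cases hc : c = z <;> simp [hc]

theorem pauliZ_basis (y : S.Side (!s)) (hy : (S.hyp (!s)).IsInvertible y) (x : S.Side s) :
    (Gate.pauliZ y hy).apply (basis x).state = S.pairing s x y • (basis x).state := by
  classical
  funext c
  simp only [Gate.apply, state, Pi.smul_apply, smul_eq_mul]
  by_cases hc : c = x
  · rw [hc]
  · simp [hc]

theorem aut_basis (α : (S.hyp s).Aut) (x : S.Side s) :
    (Gate.aut α).apply (basis x).state = (basis (α.toEquiv x)).state := by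
  classical
  funext c
  simp only [Gate.apply, state, Pi.single_apply, Equiv.symm_apply_eq]

theorem pauliX_fourier (a : S.Side s) (ha : (S.hyp s).IsInvertible a) (y : S.Side (!s)) :
    (Gate.pauliX a ha).apply (fourier y).state = S.pairing s a y • (fourier y).state := by
  classical
  funext c
  obtain ⟨b, hb⟩ := ha.bar.exists_mul c
  have hb' : (S.hyp s).n a b c = 1 := ha.n_bar_eq_one_iff.2 hb
  simp only [Gate.apply, state, Pi.smul_apply, smul_eq_mul]
  rw [Finset.sum_eq_single b (fun d _ hd => ?_) (by simp), hb', ha.weight_eq hb',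
    ← (S.isCharacter_pairing_left s y).mul_of_eq_one hb, (S.isCharacter_pairing_left s y).bar]
  · simp only [map_mul, Complex.conj_conj, Complex.ofReal_one]
    ring
  · have : (S.hyp s).n a d c = 0 := by
      by_contra h0
      have h1 := ha.n_bar_eq_one h0
      rw [n_eq_of_eq_one hb, if_neg hd] at h1
      exact zero_ne_one h1
    rw [this]
    simp

theorem pauliZ_fourier {u : S.Side (!s)} (hu : (S.hyp (!s)).IsInvertible u) {y z : S.Side (!s)}
    (h : (S.hyp (!s)).n ((S.hyp (!s)).bar u) y z = 1) :
    (Gate.pauliZ u hu).apply (fourier y).state = (fourier z).state := by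
  funext b
  simp only [Gate.apply, state]
  have hχ := S.isCharacter_pairing_right s b
  rw [hu.bar.weight_eq h, ← hχ.mul_of_eq_one h, hχ.bar]
  simp only [map_mul, Complex.conj_conj]
  ring

theorem aut_fourier {α α' : (S.hyp s).Aut} (hα : α'.toEquiv = α.toEquiv.symm)
    {β : (S.hyp (!s)).Aut} (hβ : S.IsDualAut α' β) (y : S.Side (!s)) :
    (Gate.aut α).apply (fourier y).state = (fourier (β.toEquiv y)).state := by
  funext b
  simp only [Gate.apply, state]
  rw [hβ b y, β.weight_eq, ← hα, α'.weight_eq]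

end Label

theorem Gate.apply_smul {s : Bool} (g : S.Gate s) (z : ℂ) (ψ : S.Side s → ℂ) :
    g.apply (z • ψ) = z • g.apply ψ := by
  cases g <;> funext c <;> simp only [Gate.apply, Pi.smul_apply, smul_eq_mul, Finset.mul_sum]
  · exact Finset.sum_congr rfl fun b _ => by ring
  · ring

theorem qft_smul (s : Bool) (z : ℂ) (ψ : S.Side s → ℂ) :
    S.qft s (z • ψ) = z • S.qft s ψ := by
  funext y
  simp only [qft, Pi.smul_apply, smul_eq_mul, Finset.mul_sum]
  exact Finset.sum_congr rfl fun x _ => by ring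

theorem Circuit.apply_smul {s s' : Bool} (C : S.Circuit s s') (z : ℂ) (ψ : S.Side s → ℂ) :
    C.apply (z • ψ) = z • C.apply ψ := by
  induction C with
  | nil s => rfl
  | gate g C ih => simp only [Circuit.apply, g.apply_smul, ih]
  | qft C ih => simp only [Circuit.apply, qft_smul, ih]

/-- `ψ` and `φ` agree up to a global phase. -/
def PhaseEq {X : Type*} (ψ φ : X → ℂ) : Prop := ∃ z : ℂ, ‖z‖ = 1 ∧ ψ = z • φ

theorem PhaseEq.of_eq {X : Type*} {ψ φ : X → ℂ} (h : ψ = φ) : PhaseEq ψ φ :=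
  ⟨1, by simp, by simp [h]⟩

theorem PhaseEq.apply {s s' : Bool} {C : S.Circuit s s'} {ψ φ : S.Side s → ℂ} {χ : S.Side s' → ℂ}
    (h : PhaseEq ψ φ) (h' : PhaseEq (C.apply φ) χ) : PhaseEq (C.apply ψ) χ := by
  obtain ⟨z, hz, rfl⟩ := h
  obtain ⟨w, hw, h⟩ := h'
  exact ⟨z * w, by rw [norm_mul, hz, hw, mul_one], by rw [C.apply_smul, h, mul_smul]⟩

theorem PhaseEq.norm_eq {X : Type*} {ψ φ : X → ℂ} (h : PhaseEq ψ φ) (x : X) : ‖ψ x‖ = ‖φ x‖ := by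
  obtain ⟨z, hz, rfl⟩ := h
  simp [hz]

theorem Label.norm_state_fourier {s : Bool} (y : S.Side (!s)) (b : S.Side s) :
    ‖(Label.fourier y).state b‖ ^ 2
      = (S.hyp (!s)).weight y * (S.hyp s).weight b / S.str.totalWeight * ‖S.pairing s b y‖ ^ 2 := by
  have h := div_nonneg (mul_nonneg ((S.hyp (!s)).weight_pos y).le ((S.hyp s).weight_pos b).le)
    S.str.totalWeight_pos.le
  simp only [Label.state, norm_mul, RCLike.norm_conj, Complex.norm_real, Real.norm_eq_abs,
    abs_of_nonneg (Real.sqrt_nonneg _), mul_pow, Real.sq_sqrt h]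

end StrongHypergroup

/-! ### Runs of programs -/

namespace Data

theorem size_pos (x : Data) : 0 < x.size := by cases x <;> simp [size]

theorem ofBool_injective : Function.Injective ofBool := by
  intro a b h
  cases a <;> cases b <;> simp_all [ofBool]

theorem ofBits_injective : Function.Injective ofBits := by
  intro l
  induction l with
  | nil => intro l' h; cases l' <;> simp_all [ofBits]
  | cons b l ih =>
    intro l' h
    cases l' with
    | nil => simp [ofBits] at h
    | cons b' l' =>
      simp only [ofBits, cons.injEq] at h
      rw [ofBool_injective h.1, ih h.2]

theorem length_le_size_ofBits (l : List Bool) : l.length ≤ (ofBits l).size := by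
  induction l with
  | nil => simp
  | cons b l ih => simp only [ofBits, size, List.length_cons]; omega

theorem size_ofBits_le (l : List Bool) : (ofBits l).size ≤ 4 * l.length + 1 := by
  induction l with
  | nil => simp [ofBits, size]
  | cons b l ih =>
    have : (ofBool b).size ≤ 3 := by cases b <;> simp [ofBool, size]
    simp only [ofBits, size, List.length_cons]
    omega

end Data

namespace Run

variable {ω : ℕ → Bool} {p : Prog} {x y : Data} {i j t : ℕ}

theorem input_size_le (h : Run ω p x i y j t) : x.size ≤ t := by
  induction h <;> first | omega | (simp only [Data.size] at *; omega)

/-- The factor `3` is due to a coin flip, whose output may be larger than its input. -/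
theorem output_size_le (h : Run ω p x i y j t) : y.size ≤ 3 * t := by
  induction h with
  | nil x i => have := x.size_pos; simp only [Data.size]; omega
  | flip x i =>
    have := x.size_pos
    cases ω i <;> simp only [Data.size, Data.ofBool] <;> omega
  | @pair _ _ x => have := x.size_pos; simp only [Data.size]; omega
  | _ => first | omega | (simp only [Data.size] at *; omega)

theorem coins_le (h : Run ω p x i y j t) : i ≤ j := by
  induction h <;> omega

/-- The coin sequence determines the run. -/
theorem unique (h : Run ω p x i y j t) {y' : Data} {j' t' : ℕ} (h' : Run ω p x i y' j' t') :
    y' = y ∧ j' = j ∧ t' = t := by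
  induction h generalizing y' j' t' with
  | id | nil | hd_nil | hd_cons | tl_nil | tl_cons | flip => cases h'; exact ⟨rfl, rfl, rfl⟩
  | pair _ _ ih1 ih2 =>
    cases h' with
    | pair h1 h2 =>
      obtain ⟨rfl, rfl, rfl⟩ := ih1 h1
      obtain ⟨rfl, rfl, rfl⟩ := ih2 h2
      exact ⟨rfl, rfl, rfl⟩
  | comp _ _ ih1 ih2 =>
    cases h' with
    | comp h1 h2 =>
      obtain ⟨rfl, rfl, rfl⟩ := ih1 h1
      obtain ⟨rfl, rfl, rfl⟩ := ih2 h2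
      exact ⟨rfl, rfl, rfl⟩
  | ite_true _ _ ih1 ih2 =>
    cases h' with
    | ite_true h1 h2 =>
      obtain ⟨-, rfl, rfl⟩ := ih1 h1
      obtain ⟨rfl, rfl, rfl⟩ := ih2 h2
      exact ⟨rfl, rfl, rfl⟩
    | ite_false h1 _ => cases (ih1 h1).1
  | ite_false _ _ ih1 ih2 =>
    cases h' with
    | ite_true h1 _ => cases (ih1 h1).1
    | ite_false h1 h2 =>
      obtain ⟨-, rfl, rfl⟩ := ih1 h1
      obtain ⟨rfl, rfl, rfl⟩ := ih2 h2
      exact ⟨rfl, rfl, rfl⟩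
  | loop_done _ ih1 =>
    cases h' with
    | loop_done h1 =>
      obtain ⟨-, rfl, rfl⟩ := ih1 h1
      exact ⟨rfl, rfl, rfl⟩
    | loop_step h1 _ _ => cases (ih1 h1).1
  | loop_step _ _ _ ih1 ih2 ih3 =>
    cases h' with
    | loop_done h1 => cases (ih1 h1).1
    | loop_step h1 h2 h3 =>
      obtain ⟨-, rfl, rfl⟩ := ih1 h1
      obtain ⟨rfl, rfl, rfl⟩ := ih2 h2
      obtain ⟨rfl, rfl, rfl⟩ := ih3 h3
      exact ⟨rfl, rfl, rfl⟩

/-- A run that uses no coins is a run for every coin sequence and every coin position. -/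
theorem of_no_coins (h : Run ω p x i y j t) (hij : j = i) (ω' : ℕ → Bool) (i' : ℕ) :
    Run ω' p x i' y i' t := by
  induction h generalizing i' with
  | id | nil | hd_nil | hd_cons | tl_nil | tl_cons => constructor
  | flip => omega
  | pair h1 h2 ih1 ih2 =>
    have := h1.coins_le
    have := h2.coins_le
    exact .pair (ih1 (by omega) i') (ih2 (by omega) i')
  | comp h1 h2 ih1 ih2 =>
    have := h1.coins_le
    have := h2.coins_le
    exact .comp (ih1 (by omega) i') (ih2 (by omega) i')
  | ite_true h1 h2 ih1 ih2 =>
    have := h1.coins_le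
    have := h2.coins_le
    exact .ite_true (ih1 (by omega) i') (ih2 (by omega) i')
  | ite_false h1 h2 ih1 ih2 =>
    have := h1.coins_le
    have := h2.coins_le
    exact .ite_false (ih1 (by omega) i') (ih2 (by omega) i')
  | loop_done h1 ih1 => exact .loop_done (ih1 hij i')
  | loop_step h1 h2 h3 ih1 ih2 ih3 =>
    have := h1.coins_le
    have := h2.coins_le
    have := h3.coins_le
    exact .loop_step (ih1 (by omega) i') (ih2 (by omega) i') (ih3 (by omega) i')

end Run

/-! ### Costs of deterministic computations -/

/-- The program `p` maps `x` to `y` at cost `t` without using coins. -/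
def Det (p : Prog) (x y : Data) (t : ℕ) : Prop := ∀ ω i, Run ω p x i y i t

/-- The program `p` maps `x` to `y` without using coins, at cost at most `K`. The rules below bound
costs up to constant factors, which is possible because a run costs at least the size of its
input. -/
def Ev (K : ℕ) (p : Prog) (x y : Data) : Prop := ∃ t ≤ K, Det p x y t

/-- `Computes` allows the output to depend on the coin sequence, but a run that uses no coins does
not depend on it, so that a single output serves all sequences. -/
theorem Computes.exists_ev {p : Prog} {x : Data} {ok : Data → Prop} {B : ℕ}
    (h : Computes p x ok B) : ∃ y, ok y ∧ Ev B p x y := by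
  obtain ⟨y, t, hr, hy, ht⟩ := h (fun _ => false) 0
  exact ⟨y, hy, t, ht, fun ω i => hr.of_no_coins rfl ω i⟩

namespace Ev

variable {K L M : ℕ} {p q c : Prog} {x y z a b : Data}

theorem mono (h : Ev K p x y) (hKL : K ≤ L) : Ev L p x y :=
  h.imp fun _ ht => ⟨ht.1.trans hKL, ht.2⟩

theorem input_size_le (h : Ev K p x y) : x.size ≤ K := by
  obtain ⟨t, ht, hd⟩ := h
  exact (hd (fun _ => false) 0).input_size_le.trans ht

theorem output_size_le (h : Ev K p x y) : y.size ≤ 3 * K := by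
  obtain ⟨t, ht, hd⟩ := h
  exact (hd (fun _ => false) 0).output_size_le.trans (by omega)

theorem id (h : x.size ≤ K) : Ev K .id x x := ⟨_, h, fun _ _ => .id _ _⟩

theorem nil (h : x.size ≤ K) : Ev K .nil x .nil := ⟨_, h, fun _ _ => .nil _ _⟩

theorem comp (hp : Ev K p x y) (hq : Ev L q y z) : Ev (2 * K + L) (.comp q p) x z := by
  have := hp.input_size_le
  obtain ⟨s, hs, hds⟩ := hp
  obtain ⟨t, ht, hdt⟩ := hq
  exact ⟨_, by omega, fun ω i => .comp (hds ω i) (hdt ω i)⟩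

theorem pair (hp : Ev K p x y) (hq : Ev L q x z) : Ev (2 * K + L) (.pair p q) x (.cons y z) := by
  have := hp.input_size_le
  obtain ⟨s, hs, hds⟩ := hp
  obtain ⟨t, ht, hdt⟩ := hq
  exact ⟨_, by omega, fun ω i => .pair (hds ω i) (hdt ω i)⟩

theorem ite_true (hc : Ev K c x (.cons a b)) (hp : Ev L p x y) :
    Ev (2 * K + L) (.ite c p q) x y := by
  have := hc.input_size_le
  obtain ⟨s, hs, hds⟩ := hc
  obtain ⟨t, ht, hdt⟩ := hp
  exact ⟨_, by omega, fun ω i => .ite_true (hds ω i) (hdt ω i)⟩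

theorem ite_false (hc : Ev K c x .nil) (hq : Ev L q x y) : Ev (2 * K + L) (.ite c p q) x y := by
  have := hc.input_size_le
  obtain ⟨s, hs, hds⟩ := hc
  obtain ⟨t, ht, hdt⟩ := hq
  exact ⟨_, by omega, fun ω i => .ite_false (hds ω i) (hdt ω i)⟩

theorem hd (hp : Ev K p x (.cons a b)) : Ev (5 * K) (.comp .hd p) x a :=
  (hp.comp ⟨_, hp.output_size_le, fun _ _ => .hd_cons _ _ _⟩).mono (by omega)

theorem tl (hp : Ev K p x (.cons a b)) : Ev (5 * K) (.comp .tl p) x b :=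
  (hp.comp ⟨_, hp.output_size_le, fun _ _ => .tl_cons _ _ _⟩).mono (by omega)

theorem loop_done (hc : Ev K c x .nil) : Ev (2 * K) (.loop c p) x x := by
  have := hc.input_size_le
  obtain ⟨s, hs, hds⟩ := hc
  exact ⟨_, by omega, fun ω i => .loop_done (hds ω i)⟩

theorem loop_step (hc : Ev K c x (.cons a b)) (hp : Ev L p x y) (hl : Ev M (.loop c p) y z) :
    Ev (2 * K + L + M) (.loop c p) x z := by
  have := hc.input_size_le
  obtain ⟨s, hs, hds⟩ := hc
  obtain ⟨t, ht, hdt⟩ := hp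
  obtain ⟨u, hu, hdu⟩ := hl
  exact ⟨_, by omega, fun ω i => .loop_step (hds ω i) (hdt ω i) (hdu ω i)⟩

end Ev

/-! ### Sampling programs -/

instance : MeasureTheory.IsProbabilityMeasure coins := by
  unfold coins
  infer_instance

section Samples

variable {X : Type} [Fintype X] {p q c f : Prog} {x y a b : Data} {enc : X → Data} {π : X → ℝ}
  {δ : ℝ} {B K : ℕ}

theorem Samples.mono (h : Samples p x enc π δ B) (hBK : B ≤ K) : Samples p x enc π δ K :=
  ⟨fun ω => by
    obtain ⟨y, j, t, hr, ht⟩ := h.1 ω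
    exact ⟨y, j, t, hr, ht.trans hBK⟩, h.2⟩

/-- A program inherits the output distribution of a halting program whose runs it continues. -/
theorem Samples.of_run (h : Samples q y enc π δ B)
    (hr : ∀ ω z j t, Run ω q y 0 z j t → ∃ u ≤ K + t, Run ω p x 0 z j u) :
    Samples p x enc π δ (K + B) := by
  refine ⟨fun ω => ?_, fun A => ?_⟩
  · obtain ⟨z, j, t, hz, ht⟩ := h.1 ω
    obtain ⟨u, hu, hz'⟩ := hr ω z j t hz
    exact ⟨z, j, u, hz', by omega⟩
  · have : outputProb p x (enc '' (A : Set X)) = outputProb q y (enc '' (A : Set X)) := by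
      unfold outputProb
      congr 1
      ext ω
      constructor
      · rintro ⟨z, hz, j, t, hp⟩
        obtain ⟨z', j', t', hq, -⟩ := h.1 ω
        obtain ⟨u, -, hp'⟩ := hr ω z' j' t' hq
        obtain rfl := (hp'.unique hp).1
        exact ⟨z, hz, j', t', hq⟩
      · rintro ⟨z, hz, j, t, hq⟩
        obtain ⟨u, -, hp⟩ := hr ω z j t hq
        exact ⟨z, hz, j, u, hp⟩
    rw [this]
    exact h.2 A

theorem Samples.comp (hf : Ev K f x y) (h : Samples p y enc π δ B) :
    Samples (.comp p f) x enc π δ (2 * K + B) := by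
  have hx := hf.input_size_le
  obtain ⟨t, ht, hd⟩ := hf
  exact h.of_run fun ω z j u hu => ⟨_, by omega, .comp (hd ω 0) hu⟩

theorem Samples.ite_true (hc : Ev K c x (.cons a b)) (h : Samples p x enc π δ B) :
    Samples (.ite c p q) x enc π δ (2 * K + B) := by
  have hx := hc.input_size_le
  obtain ⟨t, ht, hd⟩ := hc
  exact h.of_run fun ω z j u hu => ⟨_, by omega, .ite_true (hd ω 0) hu⟩

theorem Samples.ite_false (hc : Ev K c x .nil) (h : Samples q x enc π δ B) :
    Samples (.ite c p q) x enc π δ (2 * K + B) := by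
  have hx := hc.input_size_le
  obtain ⟨t, ht, hd⟩ := hc
  exact h.of_run fun ω z j u hu => ⟨_, by omega, .ite_false (hd ω 0) hu⟩

/-- A program that outputs a fixed element samples the point mass at that element exactly. -/
theorem Ev.samples [DecidableEq X] {u : X} (h : Ev K p x (enc u)) (henc : Function.Injective enc)
    (hδ : 0 ≤ δ) : Samples p x enc (fun z => if z = u then 1 else 0) δ K := by
  obtain ⟨t, ht, hd⟩ := h
  refine ⟨fun ω => ⟨_, _, t, hd ω 0, ht⟩, fun A => ?_⟩
  have hset : {ω | ∃ y ∈ enc '' (A : Set X), ∃ j t, Run ω p x 0 y j t}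
      = {_ω : ℕ → Bool | u ∈ A} := by
    ext ω
    constructor
    · rintro ⟨_, ⟨v, hv, rfl⟩, j, t', hr⟩
      obtain rfl := henc ((hd ω 0).unique hr).1
      exact hv
    · exact fun hu => ⟨_, ⟨u, hu, rfl⟩, 0, t, hd ω 0⟩
  unfold outputProb
  rw [hset, Finset.sum_ite_eq']
  by_cases hu : u ∈ A <;> simp [hu, hδ]

end Samples

open Polynomial

theorem eval_mono (B : ℕ[X]) {m n : ℕ} (h : m ≤ n) : B.eval m ≤ B.eval n := by
  simp only [eval_eq_sum, sum_def]
  gcongr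

/-! ### Labels as data -/

namespace StrongHypergroup.Label

variable {S : StrongHypergroup}

/-- The basis to which the element of a label belongs. No gate changes it. -/
def side {s : Bool} : S.Label s → Bool
  | basis _ => s
  | fourier _ => !s

/-- Whether the labelled state is a Fourier transform of a basis state. -/
def mode {s : Bool} : S.Label s → Bool
  | basis _ => false
  | fourier _ => true

theorem side_toggle {s : Bool} (ℓ : S.Label s) : ℓ.toggle.side = ℓ.side := by
  cases s <;> cases ℓ <;> rfl

theorem mode_toggle {s : Bool} (ℓ : S.Label s) : ℓ.toggle.mode = !ℓ.mode := by
  cases s <;> cases ℓ <;> rfl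

end StrongHypergroup.Label

open StrongHypergroup

namespace Presentation

open Data

variable {ι : Type} {S : ι → StrongHypergroup} (P : Presentation S)

/-- The representation of the element of a label. -/
def labelData (i : ι) {s : Bool} : (S i).Label s → Data
  | .basis x => P.enc i s x
  | .fourier y => P.enc i (!s) y

theorem labelData_toggle (i : ι) {s : Bool} (ℓ : (S i).Label s) :
    P.labelData i ℓ.toggle = P.labelData i ℓ := by
  cases s <;> cases ℓ <;> rfl

/-- The memory content of the simulation: the remaining gates `D`, the label of the current state,
the name of the hypergroup, and the accuracy parameter `κ`. -/
def memory (i : ι) {s : Bool} (ℓ : (S i).Label s) (D κ : Data) : Data :=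
  cons D (cons (ofBool ℓ.mode) (cons (P.labelData i ℓ) (cons (P.nameData i) κ)))

/-- Names and representations of elements have polynomial size. -/
theorem DoublyEfficientlyComputable.exists_size_le {P : Presentation S} {ε : ℕ → ℝ≥0}
    (hP : P.DoublyEfficientlyComputable ε) :
    ∃ B : ℕ[X], ∀ i, (P.nameData i).size ≤ B.eval (logCard S i) ∧
      ∀ s x, (P.enc i s x).size ≤ B.eval (logCard S i) := by
  obtain ⟨A, hA⟩ := hP.name_length
  choose C hC using fun s => (hP.efficient s).code_length
  refine ⟨4 * (A + C false + C true) + 1, fun i => ?_⟩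
  have hn := hA i
  have hs := size_ofBits_le (P.name i)
  simp only [eval_add, eval_mul, eval_ofNat, eval_one]
  refine ⟨by unfold nameData; omega, fun s x => ?_⟩
  have hc := hC s i x
  have hs := size_ofBits_le (P.code i s x)
  unfold enc
  cases s <;> omega

/-- The algorithms for the invertible elements and the automorphisms of `Side s`. -/
structure Subroutines where
  mul : Prog
  inv : Prog
  autEval : Prog
  autInv : Prog
  autDual : Prog

variable (i : ι)

/-- The subroutines `R s` compute correctly at sizes bounded by `N` and at cost at most `M`. -/
structure Subroutines.Valid (R : Bool → Subroutines) (N M : ℕ) : Prop where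
  name_size : (P.nameData i).size ≤ M
  enc_size : ∀ s x, (P.enc i s x).size ≤ M
  mul : ∀ s a b c, ((S i).hyp s).IsInvertible a → ((S i).hyp s).n a b c = 1 →
    Ev M (R s).mul (cons (P.nameData i) (cons (P.enc i s a) (P.enc i s b))) (P.enc i s c)
  inv : ∀ s a, ((S i).hyp s).IsInvertible a →
    Ev M (R s).inv (cons (P.nameData i) (P.enc i s a)) (P.enc i s (((S i).hyp s).bar a))
  autEval : ∀ s d α x, P.autDesc i s d = some α → d.length ≤ N →
    Ev M (R s).autEval (cons (P.nameData i) (cons (ofBits d) (P.enc i s x)))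
      (P.enc i s (α.toEquiv x))
  /-- The automorphism `U_α` of a Fourier transformed state acts on its label by the dual of the
  inverse of `α`. -/
  autFourier : ∀ s d α (y : (S i).Side (!s)), P.autDesc i s d = some α → d.length ≤ N →
    ∃ (α' : ((S i).hyp s).Aut) (β : ((S i).hyp (!s)).Aut) (d₁ d₂ : List Bool),
      α'.toEquiv = α.toEquiv.symm ∧ (S i).IsDualAut α' β ∧
      Ev M (R s).autInv (cons (P.nameData i) (ofBits d)) (ofBits d₁) ∧
      Ev M (R s).autDual (cons (P.nameData i) (ofBits d₁)) (ofBits d₂) ∧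
      Ev M (R (!s)).autEval (cons (P.nameData i) (cons (ofBits d₂) (P.enc i (!s) y)))
        (P.enc i (!s) (β.toEquiv y))

theorem exists_subroutines {P : Presentation S} {ε : ℕ → ℝ≥0}
    (hP : P.DoublyEfficientlyComputable ε) :
    ∃ (R : Bool → Subroutines) (B : ℕ[X]), ∀ i N, logCard S i ≤ N →
      Subroutines.Valid P i R N (B.eval N) := by
  obtain ⟨A, hA⟩ := hP.exists_size_le
  choose pm Bm hm using fun s => (hP.efficient s).mul
  choose pv Bv hv using fun s => (hP.efficient s).inv
  choose pe Be he using hP.aut_eval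
  choose pi Bi hi using hP.aut_inv
  choose pd Bd hd using hP.aut_dual
  -- Along the chain "invert, dualize, evaluate", a description is at most three times as long as
  -- the cost of the run that produced it.
  let Ci : ℕ[X] := (Bi false + Bi true).comp (2 * X)
  let Cd : ℕ[X] := (Bd false + Bd true).comp (X + 3 * Ci)
  let Ce : ℕ[X] := (Be false + Be true).comp (2 * X + 3 * Cd)
  refine ⟨fun s => ⟨pm s, pv s, pe s, pi s, pd s⟩,
    A + (Bm false + Bm true) + (Bv false + Bv true) + Ci + Cd + Ce, fun i N hN => ?_⟩
  have le_add (B : Bool → ℕ[X]) (s : Bool) (n : ℕ) : (B s).eval n ≤ (B false + B true).eval n := by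
    rw [eval_add]
    cases s <;> omega
  have hCi : Ci.eval N = (Bi false + Bi true).eval (2 * N) := by simp [Ci]
  have hCd : Cd.eval N = (Bd false + Bd true).eval (N + 3 * Ci.eval N) := by simp [Cd]
  have hCe : Ce.eval N = (Be false + Be true).eval (2 * N + 3 * Cd.eval N) := by simp [Ce]
  generalize hM : (A + (Bm false + Bm true) + (Bv false + Bv true) + Ci + Cd + Ce).eval N = M
  rw [eval_add, eval_add, eval_add, eval_add, eval_add] at hM
  have hAN := eval_mono A hN
  refine ⟨(hA i).1.trans (by omega), fun s x => ((hA i).2 s x).trans (by omega), ?_, ?_, ?_, ?_⟩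
  · intro s a b c ha h
    obtain ⟨y, rfl, he⟩ := (hm s i a b c ha h).exists_ev
    have := (le_add Bm s _).trans (eval_mono _ hN)
    exact he.mono (by omega)
  · intro s a ha
    obtain ⟨y, rfl, he⟩ := (hv s i a ha).exists_ev
    have := (le_add Bv s _).trans (eval_mono _ hN)
    exact he.mono (by omega)
  · intro s d α x h hdN
    obtain ⟨y, rfl, h'⟩ := (he s i d α x h).exists_ev
    have := (le_add Be s (logCard S i + d.length)).trans
      (eval_mono _ (show logCard S i + d.length ≤ 2 * N + 3 * Cd.eval N by omega))
    exact h'.mono (by omega)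
  · intro s d α y h hdN
    obtain ⟨-, ⟨d₁, α', rfl, h₁, hα'⟩, e₁⟩ := (hi s i d α h).exists_ev
    obtain ⟨-, ⟨d₂, β, rfl, h₂, hβ⟩, e₂⟩ := (hd s i d₁ α' h₁).exists_ev
    obtain ⟨-, rfl, e₃⟩ := (he (!s) i d₂ β y h₂).exists_ev
    have k₁ := (le_add Bi s (logCard S i + d.length)).trans
      (eval_mono _ (show logCard S i + d.length ≤ 2 * N by omega))
    have l₁ := e₁.output_size_le
    have l₁' := length_le_size_ofBits d₁
    have k₂ := (le_add Bd s (logCard S i + d₁.length)).trans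
      (eval_mono _ (show logCard S i + d₁.length ≤ N + 3 * Ci.eval N by omega))
    have l₂ := e₂.output_size_le
    have l₂' := length_le_size_ofBits d₂
    have k₃ := (le_add Be (!s) (logCard S i + d₂.length)).trans
      (eval_mono _ (show logCard S i + d₂.length ≤ 2 * N + 3 * Cd.eval N by omega))
    exact ⟨α', β, d₁, d₂, hα', hβ, e₁.mono (by omega), e₂.mono (by omega), e₃.mono (by omega)⟩

end Presentation

/-! ### The simulation program -/

namespace Prog

/-- The `n`-fold tail. -/
def drop : ℕ → Prog
  | 0 => .id
  | n + 1 => .comp .tl (drop n)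

/-- The mode of the label in the memory; true for Fourier transforms. -/
def modeProg : Prog := .comp .hd (drop 1)

/-- The representation of the element of the label in the memory. -/
def labelProg : Prog := .comp .hd (drop 2)

/-- The name of the hypergroup in the memory. -/
def nameProg : Prog := .comp .hd (drop 3)

/-- The description of the next gate in the memory. -/
def gateProg : Prog := .comp .hd (.comp .hd (drop 0))

/-- The tail of the unary number that gives the type of the next gate. -/
def tagTailProg : Prog := .comp .tl (.comp .hd gateProg)

/-- The bit string of the element, the character or the automorphism of the next gate. -/
def payloadProg : Prog := .comp .tl gateProg

/-- Apply `p` to the name, the output of `f` and the label. -/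
def callWithLabel (p f : Prog) : Prog := .comp p (.pair nameProg (.pair f labelProg))

/-- Apply `p` to the name and the output of `f`. -/
def call (p f : Prog) : Prog := .comp p (.pair nameProg f)

/-- The new label after a Pauli or automorphism gate, for labels that carry an element of
`Side e`. The tail of the tag, a unary number, distinguishes the three types of gates. -/
def updateLabel (R : Bool → Presentation.Subroutines) (e : Bool) : Prog :=
  .ite modeProg
    (.ite tagTailProg
      (.ite (.comp .tl tagTailProg)
        (callWithLabel (R e).autEval (call (R (!e)).autDual (call (R (!e)).autInv payloadProg)))
        (callWithLabel (R e).mul (call (R e).inv payloadProg)))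
      labelProg)
    (.ite tagTailProg
      (.ite (.comp .tl tagTailProg) (callWithLabel (R e).autEval payloadProg) labelProg)
      (callWithLabel (R e).mul payloadProg))

/-- Process one gate. A Fourier transform, described by `nil`, flips the mode. -/
def step (R : Bool → Presentation.Subroutines) (e : Bool) : Prog :=
  .pair (.comp .tl (.comp .hd (drop 0)))
    (.ite gateProg
      (.pair modeProg (.pair (updateLabel R e) (drop 3)))
      (.pair (.ite modeProg .nil (.pair .nil .nil)) (drop 2)))

end Prog

namespace Presentation

open Data Prog

variable {ι : Type} {S : ι → StrongHypergroup} {P : Presentation S} {i : ι} {s : Bool}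
  {R : Bool → Subroutines} {N M K : ℕ} {ℓ : (S i).Label s} {D G κ : Data}

theorem ev_drop_zero {x : Data} (h : x.size ≤ K) : Ev K (drop 0) x x := .id h

theorem ev_mode (h : (P.memory i ℓ D κ).size ≤ K) :
    Ev (25 * K) modeProg (P.memory i ℓ D κ) (ofBool ℓ.mode) :=
  (Ev.hd (Ev.tl (ev_drop_zero h))).mono (by omega)

theorem ev_drop_two (h : (P.memory i ℓ D κ).size ≤ K) :
    Ev (25 * K) (drop 2) (P.memory i ℓ D κ)
      (cons (P.labelData i ℓ) (cons (P.nameData i) κ)) :=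
  (Ev.tl (Ev.tl (ev_drop_zero h))).mono (by omega)

theorem ev_drop_three (h : (P.memory i ℓ D κ).size ≤ K) :
    Ev (125 * K) (drop 3) (P.memory i ℓ D κ) (cons (P.nameData i) κ) :=
  (Ev.tl (ev_drop_two h)).mono (by omega)

theorem ev_drop_four (h : (P.memory i ℓ D κ).size ≤ K) :
    Ev (625 * K) (drop 4) (P.memory i ℓ D κ) κ :=
  (Ev.tl (ev_drop_three h)).mono (by omega)

theorem ev_label (h : (P.memory i ℓ D κ).size ≤ K) :
    Ev (125 * K) labelProg (P.memory i ℓ D κ) (P.labelData i ℓ) :=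
  (Ev.hd (ev_drop_two h)).mono (by omega)

theorem ev_name (h : (P.memory i ℓ D κ).size ≤ K) :
    Ev (625 * K) nameProg (P.memory i ℓ D κ) (P.nameData i) :=
  (Ev.hd (ev_drop_three h)).mono (by omega)

theorem ev_gate (h : (P.memory i ℓ (cons G D) κ).size ≤ K) :
    Ev (25 * K) gateProg (P.memory i ℓ (cons G D) κ) G :=
  (Ev.hd (Ev.hd (ev_drop_zero h))).mono (by omega)

theorem ev_tagTail {a b c : Data} (h : (P.memory i ℓ (cons (cons (cons a b) c) D) κ).size ≤ K) :
    Ev (625 * K) tagTailProg (P.memory i ℓ (cons (cons (cons a b) c) D) κ) b :=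
  (Ev.tl (Ev.hd (ev_gate h))).mono (by omega)

theorem ev_payload {a b : Data} (h : (P.memory i ℓ (cons (cons a b) D) κ).size ≤ K) :
    Ev (125 * K) payloadProg (P.memory i ℓ (cons (cons a b) D) κ) b :=
  (Ev.tl (ev_gate h)).mono (by omega)

theorem ev_call {p f : Prog} {a b : Data} (h : (P.memory i ℓ D κ).size ≤ K)
    (hf : Ev M f (P.memory i ℓ D κ) a) (hp : Ev K p (cons (P.nameData i) a) b) :
    Ev (3000 * K + 2 * M) (call p f) (P.memory i ℓ D κ) b :=
  (((ev_name h).pair hf).comp hp).mono (by omega)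

theorem ev_callWithLabel {p f : Prog} {a b : Data} (h : (P.memory i ℓ D κ).size ≤ K)
    (hf : Ev M f (P.memory i ℓ D κ) a)
    (hp : Ev K p (cons (P.nameData i) (cons a (P.labelData i ℓ))) b) :
    Ev (3000 * K + 4 * M) (callWithLabel p f) (P.memory i ℓ D κ) b :=
  (((ev_name h).pair (hf.pair (ev_label h))).comp hp).mono (by omega)

/-- The label update simulates a gate up to a global phase. -/
theorem exists_ev_update (hR : Subroutines.Valid P i R N M) {g : (S i).Gate s}
    (hg : P.DescribesGate i g G) (hGN : G.size ≤ N) (hMK : M ≤ K)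
    (hK : (P.memory i ℓ (cons G D) κ).size ≤ K) :
    ∃ ℓ' : (S i).Label s, ℓ'.side = ℓ.side ∧ ℓ'.mode = ℓ.mode ∧
      PhaseEq (g.apply ℓ.state) ℓ'.state ∧
      Ev (100000 * K) (updateLabel R ℓ.side) (P.memory i ℓ (cons G D) κ) (P.labelData i ℓ') := by
  cases hg with
  | pauliX a ha =>
    cases ℓ with
    | basis x =>
      obtain ⟨z, hz⟩ := ha.exists_mul x
      exact ⟨.basis z, rfl, rfl, .of_eq (Label.pauliX_basis ha hz),
        (Ev.ite_false (ev_mode hK) (.ite_false (ev_tagTail hK) (ev_callWithLabel hK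
          (ev_payload hK) ((hR.mul s a x z ha hz).mono hMK)))).mono (by omega)⟩
    | fourier y =>
      exact ⟨.fourier y, rfl, rfl, ⟨_,
        ((S i).isCharacter_pairing_left s y).norm_of_invertible ha, Label.pauliX_fourier a ha y⟩,
        (Ev.ite_true (ev_mode hK) (.ite_false (ev_tagTail hK) (ev_label hK))).mono (by omega)⟩
  | pauliZ u hu =>
    cases ℓ with
    | basis x =>
      exact ⟨.basis x, rfl, rfl, ⟨_,
        ((S i).isCharacter_pairing_right s x).norm_of_invertible hu, Label.pauliZ_basis u hu x⟩,
        (Ev.ite_false (ev_mode hK) (.ite_true (ev_tagTail hK) (.ite_false (ev_tagTail hK).tl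
          (ev_label hK)))).mono (by omega)⟩
    | fourier y =>
      obtain ⟨z, hz⟩ := hu.bar.exists_mul y
      exact ⟨.fourier z, rfl, rfl, .of_eq (Label.pauliZ_fourier hu hz),
        (Ev.ite_true (ev_mode hK) (.ite_true (ev_tagTail hK) (.ite_false (ev_tagTail hK).tl
          (ev_callWithLabel hK (ev_call hK (ev_payload hK) ((hR.inv (!s) u hu).mono hMK))
            ((hR.mul (!s) _ y z hu.bar hz).mono hMK))))).mono (by omega)⟩
  | aut α d hd =>
    have hdN : d.length ≤ N := by
      have := length_le_size_ofBits d
      simp only [size] at hGN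
      omega
    cases ℓ with
    | basis x =>
      exact ⟨.basis (α.toEquiv x), rfl, rfl, .of_eq (Label.aut_basis α x),
        (Ev.ite_false (ev_mode hK) (.ite_true (ev_tagTail hK) (.ite_true (ev_tagTail hK).tl
          (ev_callWithLabel hK (ev_payload hK)
            ((hR.autEval s d α x hd hdN).mono hMK))))).mono (by omega)⟩
    | fourier y =>
      obtain ⟨α', β, d₁, d₂, hα', hβ, e₁, e₂, e₃⟩ := hR.autFourier s d α y hd hdN
      refine ⟨.fourier (β.toEquiv y), rfl, rfl, .of_eq (Label.aut_fourier hα' hβ y), ?_⟩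
      rw [Label.side, updateLabel, Bool.not_not]
      exact (Ev.ite_true (ev_mode hK) (.ite_true (ev_tagTail hK) (.ite_true (ev_tagTail hK).tl
          (ev_callWithLabel hK (ev_call hK (ev_call hK (ev_payload hK) (e₁.mono hMK))
            (e₂.mono hMK)) (e₃.mono hMK))))).mono (by omega)

theorem ev_step_gate {g : (S i).Gate s} (hg : P.DescribesGate i g G) {ℓ' : (S i).Label s}
    (hm : ℓ'.mode = ℓ.mode) (hK : (P.memory i ℓ (cons G D) κ).size ≤ K)
    (hu : Ev (100000 * K) (updateLabel R ℓ.side) (P.memory i ℓ (cons G D) κ) (P.labelData i ℓ')) :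
    Ev (300000 * K) (step R ℓ.side) (P.memory i ℓ (cons G D) κ) (P.memory i ℓ' D κ) := by
  have hgate : ∃ a b, G = cons a b := by cases hg <;> exact ⟨_, _, rfl⟩
  obtain ⟨a, b, rfl⟩ := hgate
  have h : Ev _ (step R ℓ.side) _ _ := (((ev_drop_zero hK).hd).tl).pair
    (.ite_true (ev_gate hK) ((ev_mode hK).pair (hu.pair (ev_drop_three hK))))
  rw [← hm] at h
  exact h.mono (by omega)

theorem ev_step_qft (hK : (P.memory i ℓ (cons nil D) κ).size ≤ K) :
    Ev (300000 * K) (step R ℓ.side) (P.memory i ℓ (cons nil D) κ)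
      (P.memory i ℓ.toggle D κ) := by
  have hflip : Ev (60 * K) (.ite modeProg .nil (.pair .nil .nil))
      (P.memory i ℓ (cons nil D) κ) (ofBool ℓ.toggle.mode) := by
    rw [Label.mode_toggle]
    have hm := ev_mode hK
    cases h : ℓ.mode
    · rw [h] at hm
      exact (Ev.ite_false hm ((Ev.nil hK).pair (Ev.nil hK))).mono (by omega)
    · rw [h] at hm
      exact (Ev.ite_true hm (Ev.nil hK)).mono (by omega)
  have h : Ev _ (step R ℓ.side) _ _ := (((ev_drop_zero hK).hd).tl).pair
    (.ite_false (ev_gate hK) (hflip.pair (ev_drop_two hK)))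
  rw [← P.labelData_toggle] at h
  exact h.mono (by omega)

theorem size_memory_le (hR : Subroutines.Valid P i R N M) :
    (P.memory i ℓ D κ).size ≤ D.size + κ.size + 2 * M + 7 := by
  have h1 := hR.name_size
  have h2 : (P.labelData i ℓ).size ≤ M := by cases ℓ <;> exact hR.enc_size _ _
  have h3 : (ofBool ℓ.mode).size ≤ 3 := by cases ℓ.mode <;> simp [ofBool, size]
  simp only [memory, size]
  omega

/-- The loop over all gates simulates a circuit up to a global phase. -/
theorem exists_ev_loop (hR : Subroutines.Valid P i R N M) {s s' : Bool} {C : (S i).Circuit s s'}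
    (hC : P.Describes i C D) (ℓ : (S i).Label s) (hDN : D.size ≤ N)
    (hK : N + κ.size + 2 * M + 7 ≤ K) :
    ∃ ℓ' : (S i).Label s', ℓ'.side = ℓ.side ∧ PhaseEq (C.apply ℓ.state) ℓ'.state ∧
      Ev (400000 * K * D.size) (.loop (.comp .hd (drop 0)) (step R ℓ.side))
        (P.memory i ℓ D κ) (P.memory i ℓ' nil κ) := by
  induction hC with
  | nil s =>
    have h : (P.memory i ℓ nil κ).size ≤ K := (size_memory_le hR).trans (by omega)
    exact ⟨ℓ, rfl, .of_eq rfl, (Ev.loop_done (ev_drop_zero h).hd).mono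
      (by simp only [size]; omega)⟩
  | @gate s s' g C G D hg hC ih =>
    have h : (P.memory i ℓ (cons G D) κ).size ≤ K := (size_memory_le hR).trans (by omega)
    simp only [size] at hDN ⊢
    obtain ⟨ℓ₁, hs₁, hm₁, hp₁, he₁⟩ := exists_ev_update hR hg (by omega) (by omega) h
    obtain ⟨ℓ', hs', hp', he'⟩ := ih ℓ₁ (by omega)
    rw [hs₁] at hs' he'
    refine ⟨ℓ', hs', hp₁.apply hp', ?_⟩
    have hstep := ev_step_gate hg hm₁ h he₁
    refine ((ev_drop_zero h).hd.loop_step hstep he').mono ?_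
    nlinarith [Nat.zero_le (K * G.size)]
  | @qft s s' C D hC ih =>
    have h : (P.memory i ℓ (cons nil D) κ).size ≤ K := (size_memory_le hR).trans (by omega)
    simp only [size] at hDN ⊢
    obtain ⟨ℓ', hs', hp', he'⟩ := ih ℓ.toggle (by omega)
    rw [Label.side_toggle] at hs' he'
    rw [← Label.qft_state] at hp'
    refine ⟨ℓ', hs', hp', ?_⟩
    refine ((ev_drop_zero h).hd.loop_step (ev_step_qft h) he').mono ?_
    nlinarith


/-! ### Measuring the final state -/

theorem samples_basis {P : Presentation S} (hinj : Function.Injective (P.code i s))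
    {p : Prog} {x : Data} {u : (S i).Side s} (h : Ev K p x (P.enc i s u)) {δ : ℝ} (hδ : 0 ≤ δ) :
    Samples p x (P.enc i s) (fun z => ‖(Label.basis u).state z‖ ^ 2) δ K := by
  classical
  have e : (fun z => ‖(Label.basis u).state z‖ ^ 2) = fun z => if z = u then (1 : ℝ) else 0 := by
    funext z
    by_cases hz : z = u <;> simp [Label.state, hz]
  rw [e]
  exact h.samples (fun a b hab => hinj (ofBits_injective hab)) hδ

theorem samples_fourier {P : Presentation S} {p : Prog} {x : Data} {δ : ℝ} {B : ℕ} :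
    ∀ {s : Bool} {y : (S i).Side (!s)},
    Samples p x (P.enc i (!!s)) ((S i).fourierProb (!s) y) δ B →
    Samples p x (P.enc i s) (fun z => ‖(Label.fourier y).state z‖ ^ 2) δ B
  | false, y => fun h => by
    simp only [Label.norm_state_fourier]
    refine cast ?_ h
    congr 1
    funext z
    exact congrArg (fun r : ℝ => _ * r ^ 2) (RCLike.norm_conj (K := ℂ) _)
  | true, y => fun h => by
    simp only [Label.norm_state_fourier]
    refine cast ?_ h
    congr 1
    funext z
    exact congrArg (fun r : ℝ => _ * r ^ 2) (RCLike.norm_conj (K := ℂ) _).symm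

end Presentation

/-! ### The complete simulation -/

namespace Prog

/-- Rearrange the input of the simulation into its initial memory content. -/
def setUp : Prog :=
  .pair (.comp .hd (drop 3)) (.pair .nil (.pair (.comp .hd (drop 2))
    (.pair (.comp .hd (drop 0)) (drop 4))))

/-- Measure the final state: sample from its distribution if it is a Fourier transform of a basis
state, and return its label otherwise. -/
def measure (sampler : Bool → Prog) (e : Bool) : Prog :=
  .ite modeProg (.comp (sampler e) (.pair nameProg (.pair labelProg (drop 4)))) labelProg

/-- The simulation of circuits that start in the basis labelled by `Side e`. -/
def simulateFrom (R : Bool → Presentation.Subroutines) (sampler : Bool → Prog) (e : Bool) : Prog :=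
  .comp (measure sampler e) (.comp (.loop (.comp .hd (drop 0)) (step R e)) setUp)

/-- The simulation of circuits. -/
def simulate (R : Bool → Presentation.Subroutines) (sampler : Bool → Prog) : Prog :=
  .ite (.comp .hd (drop 1)) (simulateFrom R sampler true) (simulateFrom R sampler false)

end Prog

theorem Samples.ite_bool {X : Type} [Fintype X] {c : Prog} {q : Bool → Prog} {x : Data}
    {enc : X → Data} {π : X → ℝ} {δ : ℝ} {B K : ℕ} :
    ∀ {b : Bool}, Ev K c x (Data.ofBool b) → Samples (q b) x enc π δ B →
      Samples (.ite c (q true) (q false)) x enc π δ (2 * K + B)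
  | false, hc, h => Samples.ite_false hc h
  | true, hc, h => Samples.ite_true hc h

namespace Presentation

open Data Prog

variable {ι : Type} {S : ι → StrongHypergroup} {P : Presentation S} {i : ι} {s : Bool}
  {R : Bool → Subroutines} {N M K : ℕ} {D κ : Data}

theorem samples_measure (hinj : ∀ s, Function.Injective (P.code i s)) {sampler : Bool → Prog}
    {δ : ℝ} (hδ : 0 ≤ δ) {B : ℕ}
    (hsampler : ∀ s (y : (S i).Side s),
      Samples (sampler s) (cons (P.nameData i) (cons (P.enc i s y) κ)) (P.enc i (!s))
        ((S i).fourierProb s y) δ B)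
    (ℓ : (S i).Label s) (hK : (P.memory i ℓ nil κ).size ≤ K) :
    Samples (measure sampler ℓ.side) (P.memory i ℓ nil κ) (P.enc i s)
      (fun z => ‖ℓ.state z‖ ^ 2) δ (5000 * K + B) := by
  cases ℓ with
  | basis x =>
    exact (Samples.ite_false (ev_mode hK)
      (samples_basis (hinj s) (ev_label hK) hδ)).mono (by omega)
  | fourier y =>
    exact (Samples.ite_true (ev_mode hK) (Samples.comp
      ((ev_name hK).pair ((ev_label hK).pair (ev_drop_four hK)))
      (samples_fourier (hsampler (!s) y)))).mono (by omega)

theorem ev_setUp {x : (S i).Side s} {f : Data}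
    (hK : (cons (P.nameData i) (cons f (cons (P.enc i s x) (cons D κ)))).size ≤ K) :
    Ev (10000 * K) setUp (cons (P.nameData i) (cons f (cons (P.enc i s x) (cons D κ))))
      (P.memory i (.basis x) D κ) := by
  have h3 := (ev_drop_zero hK).tl.tl.tl
  have h : Ev _ setUp _ (P.memory i (.basis x) D κ) :=
    h3.hd.pair ((Ev.nil hK).pair ((ev_drop_zero hK).tl.tl.hd.pair
      ((ev_drop_zero hK).hd.pair h3.tl)))
  exact h.mono (by omega)

end Presentation

end HypergroupSim

end

open HypergroupSim Polynomial in
theorem mainTheorem3 {ι : Type} (S : ι → StrongHypergroup) (P : Presentation S) (ε : ℕ → ℝ≥0)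
    (hP : P.DoublyEfficientlyComputable ε) :
    ∃ (p : Prog) (B : ℕ[X]), ∀ (i : ι) (s s' : Bool) (C : (S i).Circuit s s') (D : Data),
      P.Describes i C D → ∀ (x : (S i).Side s) (k : ℕ),
        Samples p
          (Data.cons (P.nameData i) (Data.cons (Data.ofBool s)
            (Data.cons (P.enc i s x) (Data.cons D (Data.unary k)))))
          (P.enc i s') (C.outcomeProb x) (ε k)
          (B.eval (Presentation.logCard S i + D.size + k)) := by
  obtain ⟨R, A, hR⟩ := Presentation.exists_subroutines hP
  choose sampler Bs hs using hP.sampling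
  -- With `n` the total input size, the parameter `N` below is `4 n + 1`, the size of the memory is
  -- at most `2 N + 2 A(N) + 7`, and there are at most `N` steps.
  refine ⟨Prog.simulate R sampler, (C 2000000 * (2 * X + 2 * A + 7) * (X + 1)
    + (Bs false + Bs true)).comp (4 * X + 1), fun i s s' C D hC x k => ?_⟩
  generalize hn : Presentation.logCard S i + D.size + k = n
  have hV := hR i (4 * n + 1) (by omega)
  have hκ : (Data.unary k).size ≤ 4 * k + 1 := by
    simpa [Data.unary] using Data.size_ofBits_le (List.replicate k true)
  obtain ⟨K, hKdef⟩ : ∃ K, K = 2 * (4 * n + 1) + 2 * A.eval (4 * n + 1) + 7 := ⟨_, rfl⟩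
  obtain ⟨ℓ, hside, hphase, hloop⟩ := Presentation.exists_ev_loop hV hC (.basis x)
    (κ := Data.unary k) (K := K) (by omega) (by omega)
  have hmem := Presentation.size_memory_le hV (ℓ := ℓ) (D := Data.nil) (κ := Data.unary k)
  have hnil : Data.nil.size = 1 := rfl
  have hin : (Data.cons (P.nameData i) (Data.cons (Data.ofBool s)
      (Data.cons (P.enc i s x) (Data.cons D (Data.unary k))))).size ≤ K := by
    have h1 := hV.name_size
    have h2 := hV.enc_size s x
    have h3 : (Data.ofBool s).size ≤ 3 := by cases s <;> simp [Data.ofBool, Data.size]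
    simp only [Data.size]
    omega
  have hmeas := Presentation.samples_measure (fun s => (hP.efficient s).code_injective i)
    (ε k).2 (κ := Data.unary k) (B := (Bs false + Bs true).eval (4 * n + 1))
    (fun s y => (hs s i y k).mono <| by
      refine (eval_mono (Bs s) (show _ ≤ 4 * n + 1 by omega)).trans ?_
      rw [eval_add]
      cases s <;> omega) ℓ (K := K) (by omega)
  have hprob : C.outcomeProb x = fun z => ‖ℓ.state z‖ ^ 2 :=
    funext fun z => congrArg (fun r : ℝ => r ^ 2) (hphase.norm_eq z)
  rw [hside] at hmeas
  rw [hprob]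
  refine (Samples.ite_bool (q := Prog.simulateFrom R sampler)
    (Presentation.ev_drop_zero hin).tl.hd (Samples.comp
    ((Presentation.ev_setUp hin).comp hloop) hmeas)).mono ?_
  have hDn : K * D.size ≤ K * (4 * n + 1) := Nat.mul_le_mul_left K (by omega)
  simp only [eval_comp, eval_add, eval_mul, eval_X, eval_C, eval_ofNat, eval_one]
  rw [← hKdef]
  nlinarith
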